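/- Let $\hbar,c,k_0>0$, $e\in\mathbb R$, and let $A=(A_1,A_2):\mathbb R\to\mathbb R^2$ be continuous. For $x=(x_1,x_2)\in\mathbb R^2$ and $z,t\in\mathbb R$ put $\xi=ct-z$, $\eta=ct+z$, so that $c^2t^2-z^2=\xi\eta$ and $\frac{\partial^2}{\partial z^2}-\frac1{c^2}\frac{\partial^2}{\partial t^2}=-4\frac{\partial^2}{\partial\xi\,\partial\eta}$. Write $\langle f\rangle(\xi)=\frac1\xi\int_0^\xi f(s)\,ds$ and $\lambda^2=\xi\eta-|x|^2$, let $J_n$ be the Bessel function of the first kind and $\theta$ the Heaviside step function. Consider the Klein–Fock–Gordon equation with the Volkov plane-wave potential, $$\Big(-4\frac{\partial^2}{\partial\xi\,\partial\eta}+\Delta_\perp-k_0^2+\frac{2ie}{\hbar c}\sum_{\mu=1}^2A_\mu(\xi)\frac{\partial}{\partial x_\mu}-\frac{e^2}{\hbar^2c^2}|A(\xi)|^2\Big)\Psi=0 .\qquad(1)$$ A family of tempered distributions $U_{\xi,\eta}\in\mathcal S'(\mathbb R^2)$ in the variable $x$ is called a fundamental solution of the characteristic (Goursat) problem in the region $\xi\eta\ge0$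 if, for every $\varphi\in\mathcal S(\mathbb R^2)$, the function $(\xi,\eta)\mapsto U_{\xi,\eta}(\varphi)$ is continuous on $\{\xi\eta\ge0\}$; if $U_{\xi,\eta}=\delta(x_1,x_2)$ whenever $\xi=0$ or $\eta=0$; and if, for $\xi\eta>0$, the derivatives $\partial_\eta U_{\xi,\eta}(\varphi)$ and $\partial_\xi\partial_\eta U_{\xi,\eta}(\varphi)$ exist and (1) holds when paired with every $\varphi$, the derivatives in $x$ being those of distributions. For $\kappa>0$ and $\xi\eta\ge0$ let $$\Psi^{\rm free}_\kappa=\frac1\pi\Big(\delta(\lambda^2)-\frac\kappa2\,\theta(\lambda^2)\frac{J_1(\kappa\lambda)}{\lambda}\Big)\in\mathcal S'(\mathbb R^2),\qquad \delta(\lambda^2)(\varphi)=\frac12\int_0^{2\pi}\varphi\big(\sqrt{\xi\eta}\cos\vartheta,\sqrt{\xi\eta}\sin\vartheta\big)\,d\vartheta ,$$ be the free-field solution, and define the effective mass $$k_0(\xi)=k_0\sqrt{1+\Big(\frac e{\hbar ck_0}\Big)^2\big(\langle|A|^2\rangle(\xi)-|\langle A\rangle(\xi)|^2\big)} .$$ (For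 $\xi=0$, where $\xi\eta=0$, the value given to the averages is immaterial.) Set $$\Psi_{\xi,\eta}=\exp\Big(-\frac{ie}{\hbar c}\,x\cdot\langle A\rangle(\xi)\Big)\,\Psi^{\rm free}_{k_0(\xi)} .$$ 1. $\Psi$ is a fundamental solution of the characteristic problem for (1) in the region $\xi\eta\ge0$, and it is the only one: every fundamental solution $U$ satisfies $U_{\xi,\eta}=\Psi_{\xi,\eta}$ for all $\xi\eta\ge0$. 2. For $\xi\eta\ge0$, $$\Psi_{\xi,\eta}=\frac1{4\pi^2}\int_{\mathbb R^2}e^{ik\cdot x}J_0\Big(\sqrt{\xi\eta\,\langle K_k^2\rangle(\xi)}\Big)\,dk,\qquad K_k^2(\xi)=|k|^2+k_0^2+\frac{2e}{\hbar c}A(\xi)\cdot k+\frac{e^2}{\hbar^2c^2}|A(\xi)|^2,$$ in the sense of distributions, that is, $\Psi_{\xi,\eta}(\varphi)=\frac1{4\pi^2}\int J_0\big(\sqrt{\xi\eta\langle K_k^2\rangle(\xi)}\big)\int e^{ik\cdot x}\varphi(x)\,dx\,dk$ for all $\varphi\in\mathcal S(\mathbb R^2)$. 3. If moreover $A$ is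 continuously differentiable, then for every $\varphi$ the function $(z,t)\mapsto\Psi_{ct-z,ct+z}(\varphi)$ is twice continuously differentiable on $\{c^2t^2-z^2>0\}$, and (1) holds there with $-4\,\partial^2/\partial\xi\,\partial\eta$ written as $\partial^2/\partial z^2-c^{-2}\,\partial^2/\partial t^2$. -/

import Mathlib

open MeasureTheory Set Filter Topology
open scoped SchwartzMap LineDeriv Laplacian

noncomputable section

namespace Volkov

/-- The transverse plane with coordinates `(x₁, x₂)`. -/
abbrev Plane : Type := EuclideanSpace ℝ (Fin 2)

/-- The Bessel function of the first kind of integer order `n ≥ 0`, by its power series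
`J_n(x) = ∑ (-1)^m / (m! (m+n)!) (x/2)^(2m+n)`. -/
def besselJ (n : ℕ) (x : ℝ) : ℝ :=
  ∑' m : ℕ, (-1 : ℝ) ^ m / ((m.factorial : ℝ) * ((m + n).factorial : ℝ)) * (x / 2) ^ (2 * m + n)

/-- A summable majorant of the Bessel series. -/
theorem norm_besselJ_term_le (n : ℕ) (x : ℝ) (m : ℕ) :
    ‖(-1 : ℝ) ^ m / ((m.factorial : ℝ) * ((m + n).factorial : ℝ)) * (x / 2) ^ (2 * m + n)‖ ≤
      |x / 2| ^ n * (((x / 2) ^ 2) ^ m / (m.factorial : ℝ)) := by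
  have h1 : (1 : ℝ) ≤ ((m + n).factorial : ℝ) := by exact_mod_cast Nat.succ_le_of_lt (Nat.factorial_pos _)
  have h0 : (0 : ℝ) < (m.factorial : ℝ) := by exact_mod_cast Nat.factorial_pos _
  rw [norm_mul, norm_div, norm_pow, norm_neg, norm_one, one_pow, norm_pow, Real.norm_eq_abs,
    Real.norm_eq_abs, abs_of_pos (by positivity), pow_add, pow_mul, sq_abs]
  have h2 : 1 / ((m.factorial : ℝ) * ((m + n).factorial : ℝ)) ≤ 1 / (m.factorial : ℝ) :=
    one_div_le_one_div_of_le h0 (le_mul_of_one_le_right h0.le h1)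
  calc _ ≤ 1 / (m.factorial : ℝ) * (((x / 2) ^ 2) ^ m * |x / 2| ^ n) :=
        mul_le_mul_of_nonneg_right h2 (by positivity)
    _ = _ := by ring

theorem abs_besselJ_le (n : ℕ) (x : ℝ) :
    |besselJ n x| ≤ |x / 2| ^ n * Real.exp ((x / 2) ^ 2) := by
  have hs : HasSum (fun m : ℕ => |x / 2| ^ n * (((x / 2) ^ 2) ^ m / (m.factorial : ℝ)))
      (|x / 2| ^ n * Real.exp ((x / 2) ^ 2)) := by
    apply HasSum.mul_left
    rw [Real.exp_eq_exp_ℝ]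
    exact NormedSpace.expSeries_div_hasSum_exp ((x / 2) ^ 2)
  exact tsum_of_norm_bounded hs (norm_besselJ_term_le n x)

theorem measurable_besselJ (n : ℕ) : Measurable (besselJ n) := by
  have hs : ∀ x : ℝ, Summable (fun m : ℕ =>
      (-1 : ℝ) ^ m / ((m.factorial : ℝ) * ((m + n).factorial : ℝ)) * (x / 2) ^ (2 * m + n)) :=
    fun x => Summable.of_norm_bounded
      ((Real.summable_pow_div_factorial ((x / 2) ^ 2)).mul_left (|x / 2| ^ n))
      (norm_besselJ_term_le n x)
  refine measurable_of_tendsto_metrizable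
    (f := fun N x => ∑ m ∈ Finset.range N,
      (-1 : ℝ) ^ m / ((m.factorial : ℝ) * ((m + n).factorial : ℝ)) * (x / 2) ^ (2 * m + n)) ?_ ?_
  · intro N
    fun_prop
  · rw [tendsto_pi_nhds]
    intro x
    exact (hs x).hasSum.tendsto_sum_nat

/-- For fixed `s = c²t² - z² ≥ 0`, the distribution `δ(λ²)`, `λ² = s - |x|²`, on the plane.
In polar coordinates `∫∫ φ(r, θ) δ(s - r²) r dr dθ = (1/2) ∫ φ(√s, θ) dθ`, so it is half of the
image of the arc measure `dθ` on the circle of radius `√s`. -/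
def deltaInterval (s : ℝ) : 𝓢'(Plane, ℂ) :=
  (1 / 2 : ℂ) • ((volume.restrict (Ioc 0 (2 * Real.pi))).map
    (fun θ : ℝ => (!₂[√s * Real.cos θ, √s * Real.sin θ] : Plane))).toTemperedDistribution

/-- The function `θ(λ²) J₁(κλ)/λ` of the transverse position `x`, where `λ = √(s - |x|²)`. -/
def massiveTerm (κ s : ℝ) (x : Plane) : ℂ :=
  if ‖x‖ ^ 2 < s then ((besselJ 1 (κ * √(s - ‖x‖ ^ 2)) / √(s - ‖x‖ ^ 2) : ℝ) : ℂ) else 0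

theorem norm_massiveTerm_le (κ s : ℝ) (x : Plane) :
    ‖massiveTerm κ s x‖ ≤ |κ| / 2 * Real.exp (κ ^ 2 * s / 4) := by
  unfold massiveTerm
  split_ifs with h
  · have hl : 0 < s - ‖x‖ ^ 2 := by linarith
    have hq : 0 < √(s - ‖x‖ ^ 2) := Real.sqrt_pos.2 hl
    rw [Complex.norm_real, Real.norm_eq_abs, abs_div, abs_of_pos hq, div_le_iff₀ hq]
    refine (abs_besselJ_le 1 _).trans ?_
    have hexp : Real.exp ((κ * √(s - ‖x‖ ^ 2) / 2) ^ 2) ≤ Real.exp (κ ^ 2 * s / 4) := by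
      apply Real.exp_le_exp.2
      rw [div_pow, mul_pow, Real.sq_sqrt hl.le]
      nlinarith [mul_nonneg (sq_nonneg κ) (sq_nonneg ‖x‖)]
    rw [pow_one, abs_div, abs_mul, abs_of_pos hq, abs_of_pos (by norm_num : (0 : ℝ) < 2)]
    calc _ ≤ |κ| * √(s - ‖x‖ ^ 2) / 2 * Real.exp (κ ^ 2 * s / 4) :=
          mul_le_mul_of_nonneg_left hexp (by positivity)
      _ = _ := by ring
  · rw [norm_zero]
    positivity

theorem measurable_massiveTerm (κ s : ℝ) : Measurable (massiveTerm κ s) := by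
  unfold massiveTerm
  refine Measurable.ite (measurableSet_lt (by fun_prop) measurable_const) ?_ measurable_const
  refine Complex.measurable_ofReal.comp (Measurable.div ?_ (by fun_prop))
  exact (measurable_besselJ 1).comp (by fun_prop)

theorem memLp_massiveTerm (κ s : ℝ) : MemLp (massiveTerm κ s) 1 := by
  rw [memLp_one_iff_integrable]
  have hsub : Function.support (massiveTerm κ s) ⊆ Metric.closedBall 0 √s := by
    intro x hx
    by_contra hn
    apply hx
    unfold massiveTerm
    rw [if_neg]
    intro h
    apply hn
    rw [mem_closedBall_zero_iff]
    exact Real.le_sqrt_of_sq_le h.le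
  rw [← integrableOn_iff_integrable_of_support_subset hsub]
  refine Measure.integrableOn_of_bounded
    (isCompact_closedBall (0 : Plane) √s).measure_lt_top.ne
    (measurable_massiveTerm κ s).aestronglyMeasurable
    (M := |κ| / 2 * Real.exp (κ ^ 2 * s / 4)) ?_
  exact Eventually.of_forall (norm_massiveTerm_le κ s)

/-- `θ(λ²) J₁(κλ)/λ` as a distribution on the plane. -/
def massiveDistribution (κ s : ℝ) : 𝓢'(Plane, ℂ) :=
  haveI : Fact ((1 : ENNReal) ≤ 1) := ⟨le_rfl⟩
  Lp.toTemperedDistribution ((memLp_massiveTerm κ s).toLp (massiveTerm κ s))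

/-- The free-field solution with mass parameter `κ`, at `s = c²t² - z² ≥ 0`:
`(1/π) (δ(λ²) - (κ/2) θ(λ²) J₁(κλ)/λ)`. -/
def freeSolution (κ s : ℝ) : 𝓢'(Plane, ℂ) :=
  (1 / Real.pi : ℂ) • (deltaInterval s - (κ / 2 : ℂ) • massiveDistribution κ s)

/-- The average `⟨f⟩(ξ) = (1/ξ) ∫₀^ξ f`. -/
def average {F : Type*} [NormedAddCommGroup F] [NormedSpace ℝ F] (f : ℝ → F) (ξ : ℝ) : F :=
  ξ⁻¹ • ∫ s in (0 : ℝ)..ξ, f s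

/-- The effective mass `k₀(ξ) = k₀ √(1 + (e/ħck₀)² (⟨A²⟩ - ⟨A⟩²))`. -/
def effectiveMass (e ħ c k₀ : ℝ) (A : ℝ → Plane) (ξ : ℝ) : ℝ :=
  k₀ * √(1 + (e / (ħ * c * k₀)) ^ 2 * (average (fun s => ‖A s‖ ^ 2) ξ - ‖average A ξ‖ ^ 2))

/-- The phase `exp (-(ie/ħc) (x₁⟨A₁⟩ + x₂⟨A₂⟩))`. -/
def phase (e ħ c : ℝ) (A : ℝ → Plane) (ξ : ℝ) (x : Plane) : ℂ :=
  Complex.exp (-(Complex.I * e / (ħ * c)) * (inner ℝ x (average A ξ) : ℝ))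

/-- The free-field solution with mass `k₀(ξ)`, multiplied by the phase; here `ξ = ct - z`,
`η = ct + z`, so that `c²t² - z² = ξη`. -/
def volkovSolution (e ħ c k₀ : ℝ) (A : ℝ → Plane) (ξ η : ℝ) : 𝓢'(Plane, ℂ) :=
  TemperedDistribution.smulLeftCLM ℂ (phase e ħ c A ξ)
    (freeSolution (effectiveMass e ħ c k₀ A ξ) (ξ * η))

/-- The transverse part `Δ_⊥ - k₀² + (2ie/ħc) A_μ∂_μ - (e²/ħ²c²) A_μ²` of the Klein-Fock-Gordon
operator, for the value `a` of the potential; derivatives are those of distributions. -/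
def transverseOperator (e ħ c k₀ : ℝ) (a : Plane) (T : 𝓢'(Plane, ℂ)) : 𝓢'(Plane, ℂ) :=
  Δ T - ((k₀ ^ 2 : ℝ) : ℂ) • T + (2 * Complex.I * e / (ħ * c) : ℂ) • ∂_{a} T
    - ((e ^ 2 / (ħ ^ 2 * c ^ 2) * ‖a‖ ^ 2 : ℝ) : ℂ) • T

/-- `U ξ η` (a tempered distribution in `x₁, x₂`) is a fundamental solution of the characteristic
problem in the closed region `ξη ≥ 0`: it depends continuously on `(ξ, η)` there (weakly), it
equals `δ(x₁, x₂)` on both characteristics `ξ = 0` and `η = 0`, and for `ξη > 0` it solves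
`-4 ∂²U/∂ξ∂η + (Δ_⊥ - k₀² + (2ie/ħc) A_μ∂_μ - (e²/ħ²c²) A_μ²) U = 0`. -/
structure IsFundamentalSolution (e ħ c k₀ : ℝ) (A : ℝ → Plane)
    (U : ℝ → ℝ → 𝓢'(Plane, ℂ)) : Prop where
  continuousOn : ∀ φ : 𝓢(Plane, ℂ), ContinuousOn (fun p : ℝ × ℝ => U p.1 p.2 φ) {p | 0 ≤ p.1 * p.2}
  boundary : ∀ ξ η : ℝ, ξ * η = 0 → U ξ η = TemperedDistribution.delta 0
  differentiable : ∀ φ : 𝓢(Plane, ℂ), ∀ ξ η : ℝ, 0 < ξ * η →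
    DifferentiableAt ℝ (fun y => U ξ y φ) η
  equation : ∀ φ : 𝓢(Plane, ℂ), ∀ ξ η : ℝ, 0 < ξ * η →
    ∃ w : ℂ, HasDerivAt (fun x => deriv (fun y => U x y φ) η) w ξ ∧
      -4 * w + transverseOperator e ħ c k₀ (A ξ) (U ξ η) φ = 0

/-- `K²(ξ) = k² + k₀² + (2e/ħc) (A·k) + (e²/ħ²c²) A²`. -/
def momentumParameter (e ħ c k₀ : ℝ) (A : ℝ → Plane) (k : Plane) (ξ : ℝ) : ℝ :=
  ‖k‖ ^ 2 + k₀ ^ 2 + 2 * e / (ħ * c) * inner ℝ (A ξ) k + e ^ 2 / (ħ ^ 2 * c ^ 2) * ‖A ξ‖ ^ 2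

end Volkov

end

/-! Existence. Paired with `𝓕 ρ`, the transverse operator becomes multiplication of `ρ` by -K² at
momentum k = 2πζ (`transverseOperator_fourier`). So for each k one needs u with 4 ∂_ξ∂_η u + K²(ξ) u
= 0 and u = 1 on both axes. With j(w) = J₀(√w) and w = η ∫₀^ξ K², one has ∂_ξ∂_η j(w) = K² (w j'' +
j'), and Bessel's equation w j'' + j' + j/4 = 0 makes j(w) the solution. Since w = ξη⟨K²⟩, this is
the Fourier representation claimed.

It agrees with the closed form because completing the square gives ⟨K²⟩ = |k + (e/ħc)⟨A⟩|² + k₀(ξ)²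
(`average_momentumParameter`). The shift of k is the phase, and the variance of A is the correction
to the mass. What remains is the Fourier transform of the free solution (`freeSolution_fourier`):
Bessel's integral handles the circle and Sonine's convolution formula `besselEntire_convolution` the
mass term.

Differentiation under the integral is legitimate because every derivative of j is bounded by 1 on
[0, ∞) (`abs_besselEntire_le_one`) and because w is coercive in k when ξη > 0
(`smul_symbolPrimitive_mem_interior`). The primitive ∫₀^ξ K² is C¹ for continuous A and C² for A of
class C¹, whence the last claim.

Uniqueness. On the Fourier side the difference F of two solutions has zero data and satisfies 4
∂_ξ∂_η F(ρ) = -∑ aᵢ F(mᵢ ρ), with fixed symbols mᵢ. For `ρ` of compact support, a product of N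
symbols times `ρ`, divided by N!, stays bounded in the Schwartz space, so uniform boundedness
(`exists_uniform_bound`) gives |F| ≤ C N! on such products. Integrating the equation n times yields
|F(ρ)| ≤ C (α ξη)ⁿ n!/(n!)², which tends to 0. Compactly supported functions are dense
(`eq_zero_of_compactSupport`), hence F = 0. -/

open MeasureTheory Set Filter Topology
open scoped SchwartzMap LineDeriv Laplacian FourierTransform
noncomputable section
namespace Volkov

/-! ### The entire function J₀(√w) and its derivatives. -/

/-- The `n`-th derivative of the entire function `w ↦ J₀(√w)`. -/
def besselEntire (n : ℕ) (w : ℝ) : ℝ :=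
  ∑' m : ℕ, (-1 / 4 : ℝ) ^ (m + n) / (((m + n).factorial : ℝ) * (m.factorial : ℝ)) * w ^ m

theorem abs_besselEntire_coeff_le (n m : ℕ) :
    |(-1 / 4 : ℝ) ^ (m + n) / (((m + n).factorial : ℝ) * (m.factorial : ℝ))| ≤
      1 / (m.factorial : ℝ) := by
  have h0 : (0 : ℝ) < m.factorial := by positivity
  have h1 : (1 : ℝ) ≤ (m + n).factorial := by exact_mod_cast Nat.succ_le_of_lt (Nat.factorial_pos _)
  rw [abs_div, abs_pow, abs_of_pos (by positivity : (0 : ℝ) < ((m + n).factorial : ℝ) * m.factorial)]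
  apply div_le_div₀ zero_le_one _ h0 (le_mul_of_one_le_left h0.le h1)
  exact pow_le_one₀ (abs_nonneg _) (by rw [abs_le]; norm_num)

theorem norm_besselEntire_term_le (n m : ℕ) (w : ℝ) :
    ‖(-1 / 4 : ℝ) ^ (m + n) / (((m + n).factorial : ℝ) * (m.factorial : ℝ)) * w ^ m‖ ≤
      |w| ^ m / (m.factorial : ℝ) := by
  rw [norm_mul, norm_pow, Real.norm_eq_abs, Real.norm_eq_abs]
  calc _ ≤ 1 / (m.factorial : ℝ) * |w| ^ m :=
        mul_le_mul_of_nonneg_right (abs_besselEntire_coeff_le n m) (by positivity)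
    _ = _ := by ring

theorem summable_besselEntire (n : ℕ) (w : ℝ) :
    Summable fun m : ℕ =>
      (-1 / 4 : ℝ) ^ (m + n) / (((m + n).factorial : ℝ) * (m.factorial : ℝ)) * w ^ m :=
  Summable.of_norm_bounded (Real.summable_pow_div_factorial |w|)
    (norm_besselEntire_term_le n · w)

theorem hasDerivAt_besselEntire (n : ℕ) (w : ℝ) :
    HasDerivAt (besselEntire n) (besselEntire (n + 1) w) w := by
  set R : ℝ := |w| + 1 with hR
  have hR0 : 0 ≤ R := by positivity
  have hu : Summable fun m : ℕ => (m : ℝ) * R ^ (m - 1) / (m.factorial : ℝ) := by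
    rw [← summable_nat_add_iff 1]
    refine (Real.summable_pow_div_factorial R).congr fun m => ?_
    rw [Nat.factorial_succ, Nat.add_sub_cancel]
    push_cast
    field_simp
  have key := hasDerivAt_tsum_of_isPreconnected (t := Metric.ball (0 : ℝ) R) (y₀ := w) (y := w)
    (g := fun (m : ℕ) (x : ℝ) =>
      (-1 / 4 : ℝ) ^ (m + n) / (((m + n).factorial : ℝ) * (m.factorial : ℝ)) * x ^ m)
    (g' := fun (m : ℕ) (x : ℝ) =>
      (-1 / 4 : ℝ) ^ (m + n) / (((m + n).factorial : ℝ) * (m.factorial : ℝ)) *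
        (m * x ^ (m - 1)))
    hu Metric.isOpen_ball (convex_ball 0 R).isPreconnected
    (fun m y _ => (hasDerivAt_pow m y).const_mul _) ?_ (by simp [hR])
    (summable_besselEntire n w) (by simp [hR])
  · change HasDerivAt (fun z => _) _ w
    convert! key using 1
    -- The differentiated series has no m = 0 term; shifting the index turns it into the series of
    -- order n + 1.
    rw [besselEntire, Summable.tsum_eq_zero_add (f := fun m : ℕ =>
      (-1 / 4 : ℝ) ^ (m + n) / (((m + n).factorial : ℝ) * (m.factorial : ℝ)) *
        (m * w ^ (m - 1)))]
    · simp only [Nat.cast_zero, zero_mul, mul_zero, zero_add, Nat.add_sub_cancel]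
      refine tsum_congr fun m => ?_
      rw [Nat.factorial_succ m, show m + 1 + n = m + (n + 1) by ring]
      push_cast
      field_simp
    · refine Summable.of_norm_bounded hu fun m => ?_
      rw [norm_mul, norm_mul, norm_pow, Real.norm_eq_abs, Real.norm_eq_abs, Real.norm_eq_abs,
        Nat.abs_cast]
      calc _ ≤ 1 / (m.factorial : ℝ) * (m * R ^ (m - 1)) := by
            gcongr
            · exact abs_besselEntire_coeff_le n m
            · linarith
        _ = _ := by ring
  · intro m y hy
    rw [mem_ball_zero_iff, Real.norm_eq_abs] at hy
    rw [norm_mul, norm_mul, norm_pow, Real.norm_eq_abs, Real.norm_eq_abs, Real.norm_eq_abs,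
      Nat.abs_cast]
    calc _ ≤ 1 / (m.factorial : ℝ) * (m * R ^ (m - 1)) := by
          gcongr
          exact abs_besselEntire_coeff_le n m
      _ = _ := by ring

theorem continuous_besselEntire (n : ℕ) : Continuous (besselEntire n) :=
  continuous_iff_continuousAt.2 fun w => (hasDerivAt_besselEntire n w).continuousAt

/-- The Bessel equation, differentiated `n` times. -/
theorem besselEntire_recurrence (n : ℕ) (w : ℝ) :
    w * besselEntire (n + 2) w + (n + 1) * besselEntire (n + 1) w + besselEntire n w / 4 = 0 := by
  -- Multiplication by w shifts the coefficients of order n + 2 to those of order n + 1 times m, so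
  -- the equation can be checked power by power.
  have h2 : w * besselEntire (n + 2) w = ∑' m : ℕ, (m : ℝ) *
      ((-1 / 4 : ℝ) ^ (m + n + 1) / (((m + n + 1).factorial : ℝ) * (m.factorial : ℝ)) * w ^ m) := by
    rw [besselEntire, ← tsum_mul_left, Summable.tsum_eq_zero_add (f := fun m : ℕ => (m : ℝ) *
      ((-1 / 4 : ℝ) ^ (m + n + 1) / (((m + n + 1).factorial : ℝ) * (m.factorial : ℝ)) * w ^ m))]
    · simp only [Nat.cast_zero, zero_mul, zero_add]
      refine tsum_congr fun m => ?_
      rw [Nat.factorial_succ m, show m + 1 + n + 1 = m + (n + 2) by ring, pow_succ w]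
      push_cast
      field_simp
    · rw [← summable_nat_add_iff 1]
      refine ((summable_besselEntire (n + 2) w).mul_left w).congr fun m => ?_
      rw [Nat.factorial_succ m, show m + 1 + n + 1 = m + (n + 2) by ring, pow_succ w]
      push_cast
      field_simp
  have hs1 := summable_besselEntire (n + 1) w
  have hs0 := summable_besselEntire n w
  have hs2 : Summable fun m : ℕ => (m : ℝ) *
      ((-1 / 4 : ℝ) ^ (m + n + 1) / (((m + n + 1).factorial : ℝ) * (m.factorial : ℝ)) * w ^ m) := by
    have := ((hs1.mul_left ((n : ℝ) + 1)).add (hs0.div_const 4)).neg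
    refine this.congr fun m => ?_
    rw [← add_assoc, Nat.factorial_succ (m + n), pow_succ]
    push_cast
    field_simp
    ring
  rw [h2, besselEntire, besselEntire, ← tsum_mul_left, ← tsum_div_const,
    ← hs2.tsum_add (hs1.mul_left _), ← (hs2.add (hs1.mul_left _)).tsum_add (hs0.div_const 4)]
  convert tsum_zero with m
  rw [← add_assoc, Nat.factorial_succ (m + n), pow_succ]
  push_cast
  field_simp
  ring

/-- Energy argument: by the Bessel equation, x j_{n+1}² + j_n²/4 has derivative -(2n+1) j_{n+1}², so
for w ≥ 0 it is at most its value j_n(0)²/4 at the origin. The bound is uniform in n, so one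
integrable majorant |ρ| serves for all orders. -/
theorem abs_besselEntire_le_one (n : ℕ) {w : ℝ} (hw : 0 ≤ w) : |besselEntire n w| ≤ 1 := by
  set E : ℝ → ℝ := fun x => x * besselEntire (n + 1) x ^ 2 + besselEntire n x ^ 2 / 4 with hE
  have hd : ∀ x, HasDerivAt E (-(2 * n + 1) * besselEntire (n + 1) x ^ 2) x := by
    intro x
    have h1 := hasDerivAt_besselEntire n x
    have h2 := hasDerivAt_besselEntire (n + 1) x
    refine HasDerivAt.congr_deriv (((hasDerivAt_id x).mul (h2.pow 2)).add ((h1.pow 2).div_const 4)) ?_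
    have hr := besselEntire_recurrence n x
    simp only [id, Pi.pow_apply]
    norm_num
    linear_combination (2 * besselEntire (n + 1) x) * hr
  have hanti : Antitone E := by
    refine antitone_of_deriv_nonpos (fun x => (hd x).differentiableAt) fun x => ?_
    rw [(hd x).deriv]
    nlinarith [mul_nonneg (by positivity : (0 : ℝ) ≤ 2 * n + 1) (sq_nonneg (besselEntire (n + 1) x))]
  have h := hanti hw
  have h0 : |besselEntire n 0| ≤ 1 := by
    rw [besselEntire, tsum_eq_single 0 (by intro b hb; simp [hb])]
    simpa using abs_besselEntire_coeff_le n 0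
  simp only [hE, zero_mul, zero_add] at h
  have h0' : besselEntire n 0 ^ 2 ≤ 1 := by rw [← sq_abs]; exact pow_le_one₀ (abs_nonneg _) h0
  rw [← sq_le_one_iff_abs_le_one]
  nlinarith [mul_nonneg hw (sq_nonneg (besselEntire (n + 1) w))]

theorem besselEntire_zero_right : besselEntire 0 0 = 1 := by
  rw [besselEntire, tsum_eq_single 0 (by intro b hb; simp [hb])]
  simp

theorem besselJ_zero_sqrt {w : ℝ} (hw : 0 ≤ w) : besselJ 0 (√w) = besselEntire 0 w := by
  refine tsum_congr fun m => ?_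
  rw [add_zero, add_zero, pow_mul, div_pow, Real.sq_sqrt hw, div_pow, neg_div, neg_pow (1 / 4 : ℝ),
    one_div_pow]
  norm_num
  ring

/-- Shows the mass term to be an entire function of λ², without singularity at λ = 0. -/
theorem besselJ_one_div_sqrt (κ : ℝ) {v : ℝ} (hv : 0 < v) :
    besselJ 1 (κ * √v) / √v = -2 * κ * besselEntire 1 (κ ^ 2 * v) := by
  have hs : 0 < √v := Real.sqrt_pos.2 hv
  rw [besselJ, besselEntire, ← tsum_div_const, ← tsum_mul_left]
  refine tsum_congr fun m => ?_
  have h : (κ * √v / 2) ^ (2 * m + 1) = (κ ^ 2 * v) ^ m / 4 ^ m * (κ * √v / 2) := by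
    rw [pow_succ, pow_mul, div_pow, mul_pow, Real.sq_sqrt hv.le, div_pow]
    norm_num
  rw [h, neg_div, neg_pow (1 / 4 : ℝ), one_div_pow, pow_succ, pow_succ]
  field_simp
  ring

/-! ### Momentum integrals of Bessel functions of a linear combination of symbols. -/

section SpectralIntegral

variable {ι : Type} [Fintype ι]

/-- The integral `∫ j_n(∑ vᵢ mᵢ(ζ)) ρ(ζ) dζ`, with `j_n` the `n`-th derivative of
`w ↦ J₀(√w)`. -/
def spectralIntegral (m : ι → Plane → ℝ) (n : ℕ) (ρ : 𝓢(Plane, ℂ)) (v : ι → ℝ) : ℂ :=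
  ∫ ζ, (besselEntire n (∑ i, v i * m i ζ) : ℂ) * ρ ζ

/-- The parameters `v` for which the symbol `∑ vᵢ mᵢ` is nonnegative. -/
def symbolCone (m : ι → Plane → ℝ) : Set (ι → ℝ) := {v | ∀ ζ, 0 ≤ ∑ i, v i * m i ζ}

/-- Multiplication of a Schwartz function by a real function of temperate growth. -/
abbrev mulSymbol (g : Plane → ℝ) : 𝓢(Plane, ℂ) →L[ℝ] 𝓢(Plane, ℂ) :=
  SchwartzMap.smulLeftCLM ℂ g

theorem mulSymbol_apply {g : Plane → ℝ} (hg : g.HasTemperateGrowth) (ρ : 𝓢(Plane, ℂ))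
    (ζ : Plane) : mulSymbol g ρ ζ = (g ζ : ℂ) * ρ ζ := by
  rw [SchwartzMap.smulLeftCLM_apply_apply hg, Complex.real_smul]

variable {m : ι → Plane → ℝ} (hm : ∀ i, (m i).HasTemperateGrowth)

include hm in
theorem continuous_spectralIntegrand (n : ℕ) (ρ : 𝓢(Plane, ℂ)) (v : ι → ℝ) :
    Continuous fun ζ => (besselEntire n (∑ i, v i * m i ζ) : ℂ) * ρ ζ := by
  have hc : ∀ i, Continuous (m i) := fun i => (hm i).1.continuous
  have := continuous_besselEntire n
  have := ρ.continuous
  fun_prop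

theorem norm_spectralIntegrand_le (n : ℕ) (ρ : 𝓢(Plane, ℂ)) {v : ι → ℝ} (hv : v ∈ symbolCone m)
    (ζ : Plane) : ‖(besselEntire n (∑ i, v i * m i ζ) : ℂ) * ρ ζ‖ ≤ ‖ρ ζ‖ := by
  rw [norm_mul, Complex.norm_real, Real.norm_eq_abs]
  exact mul_le_of_le_one_left (norm_nonneg _) (abs_besselEntire_le_one n (hv ζ))

include hm in
theorem integrable_spectralIntegrand (n : ℕ) (ρ : 𝓢(Plane, ℂ)) {v : ι → ℝ}
    (hv : v ∈ symbolCone m) :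
    Integrable fun ζ => (besselEntire n (∑ i, v i * m i ζ) : ℂ) * ρ ζ :=
  ρ.integrable.norm.mono' (continuous_spectralIntegrand hm n ρ v).aestronglyMeasurable
    (Eventually.of_forall (norm_spectralIntegrand_le n ρ hv))

include hm in
theorem continuousOn_spectralIntegral (n : ℕ) (ρ : 𝓢(Plane, ℂ)) :
    ContinuousOn (spectralIntegral m n ρ) (symbolCone m) := by
  refine continuousOn_of_dominated (bound := fun ζ => ‖ρ ζ‖)
    (fun v _ => (continuous_spectralIntegrand hm n ρ v).aestronglyMeasurable)
    (fun v hv => Eventually.of_forall (norm_spectralIntegrand_le n ρ hv)) ρ.integrable.norm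
    (Eventually.of_forall fun ζ => Continuous.continuousOn ?_)
  have := continuous_besselEntire n
  fun_prop

include hm in
-- A derivative in vᵢ raises the order of j by one and multiplies `ρ` by mᵢ, which leaves it a
-- Schwartz function. Interior points of the cone are needed so that the argument of j stays
-- nonnegative nearby and the bound by 1 applies.
theorem hasFDerivAt_spectralIntegral (n : ℕ) (ρ : 𝓢(Plane, ℂ)) {v : ι → ℝ}
    (hv : v ∈ interior (symbolCone m)) :
    HasFDerivAt (spectralIntegral m n ρ)
      (∑ i, (ContinuousLinearMap.proj (R := ℝ) (φ := fun _ : ι => ℝ) i).smulRight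
        (spectralIntegral m (n + 1) (mulSymbol (m i) ρ) v)) v := by
  have key := hasFDerivAt_integral_of_dominated_of_fderiv_le (𝕜 := ℝ) (μ := volume)
    (F := fun (v : ι → ℝ) (ζ : Plane) => (besselEntire n (∑ i, v i * m i ζ) : ℂ) * ρ ζ)
    (F' := fun v ζ => ∑ i, (ContinuousLinearMap.proj (R := ℝ) (φ := fun _ : ι => ℝ) i).smulRight
        ((besselEntire (n + 1) (∑ i, v i * m i ζ) : ℂ) * mulSymbol (m i) ρ ζ))
    (bound := fun ζ => ∑ i : ι, ‖mulSymbol (m i) ρ ζ‖) (x₀ := v)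
    (s := interior (symbolCone m)) (isOpen_interior.mem_nhds hv)
    (Eventually.of_forall fun v => (continuous_spectralIntegrand hm n ρ v).aestronglyMeasurable)
    (integrable_spectralIntegrand hm n ρ (interior_subset hv)) ?_ ?_ ?_ ?_
  · refine key.congr_fderiv ?_
    rw [integral_finsetSum]
    · refine Finset.sum_congr rfl fun i _ => ?_
      exact ((ContinuousLinearMap.smulRightL ℝ (ι → ℝ) ℂ
        (ContinuousLinearMap.proj (R := ℝ) (φ := fun _ : ι => ℝ) i)).integral_comp_comm
        (integrable_spectralIntegrand hm (n + 1) (mulSymbol (m i) ρ) (interior_subset hv)))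
    · intro i _
      exact (ContinuousLinearMap.smulRightL ℝ (ι → ℝ) ℂ
        (ContinuousLinearMap.proj (R := ℝ) (φ := fun _ : ι => ℝ) i)).integrable_comp
        (integrable_spectralIntegrand hm (n + 1) (mulSymbol (m i) ρ) (interior_subset hv))
  · refine Continuous.aestronglyMeasurable (continuous_finsetSum _ fun i _ => ?_)
    exact (ContinuousLinearMap.smulRightL ℝ (ι → ℝ) ℂ
        (ContinuousLinearMap.proj (R := ℝ) (φ := fun _ : ι => ℝ) i)).continuous.comp
        (continuous_spectralIntegrand hm (n + 1) (mulSymbol (m i) ρ) v)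
  · refine Eventually.of_forall fun ζ v hv => (norm_sum_le _ _).trans ?_
    refine Finset.sum_le_sum fun i _ => ?_
    rw [ContinuousLinearMap.norm_smulRight_apply]
    have h1 : ‖ContinuousLinearMap.proj (R := ℝ) (φ := fun _ : ι => ℝ) i‖ ≤ 1 :=
      ContinuousLinearMap.opNorm_le_bound _ zero_le_one fun x => by
        simpa using norm_le_pi_norm x i
    calc _ ≤ 1 * ‖mulSymbol (m i) ρ ζ‖ := by
          gcongr
          exact norm_spectralIntegrand_le (n + 1) (mulSymbol (m i) ρ) (interior_subset hv) ζ
      _ = _ := one_mul _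
  · exact integrable_finsetSum _ fun i _ => (mulSymbol (m i) ρ).integrable.norm
  · refine Eventually.of_forall fun ζ v _ => ?_
    have h1 : HasFDerivAt (fun v : ι → ℝ => ∑ i, v i * m i ζ)
        (∑ i, (m i ζ) • ContinuousLinearMap.proj (R := ℝ) (φ := fun _ : ι => ℝ) i) v :=
      HasFDerivAt.fun_sum fun i _ =>
        (ContinuousLinearMap.proj (R := ℝ) (φ := fun _ : ι => ℝ) i).hasFDerivAt.mul_const (m i ζ)
    have h2 := (hasDerivAt_besselEntire n (∑ i, v i * m i ζ)).comp_hasFDerivAt v h1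
    have h3 := (Complex.ofRealCLM.hasFDerivAt.comp v h2).mul_const (ρ ζ)
    refine h3.congr_fderiv ?_
    ext x
    simp only [mulSymbol_apply (hm _)]
    simp [Finset.mul_sum]
    refine Finset.sum_congr rfl fun i _ => ?_
    ring

include hm in
-- The derivative is built from integrals of the same kind with another order and another density,
-- so the induction runs over all n and `ρ` at once.
theorem contDiffOn_spectralIntegral (N : ℕ) (n : ℕ) (ρ : 𝓢(Plane, ℂ)) :
    ContDiffOn ℝ N (spectralIntegral m n ρ) (interior (symbolCone m)) := by
  induction N generalizing n ρ with
  | zero =>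
    exact contDiffOn_zero.2 ((continuousOn_spectralIntegral hm n ρ).mono interior_subset)
  | succ N ih =>
    push_cast
    rw [contDiffOn_succ_iff_fderiv_of_isOpen isOpen_interior]
    refine ⟨fun v hv =>
      (hasFDerivAt_spectralIntegral hm n ρ hv).differentiableAt.differentiableWithinAt,
      fun h => by simp at h, ?_⟩
    refine ContDiffOn.congr (f := fun v => ∑ i,
      (ContinuousLinearMap.smulRightL ℝ (ι → ℝ) ℂ (ContinuousLinearMap.proj i))
        (spectralIntegral m (n + 1) (mulSymbol (m i) ρ) v)) ?_
      fun v hv => (hasFDerivAt_spectralIntegral hm n ρ hv).fderiv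
    exact ContDiffOn.sum fun i _ => (ContinuousLinearMap.contDiff _).comp_contDiffOn
      (ih (n + 1) (mulSymbol (m i) ρ))

include hm in
-- The Bessel equation at w = ∑ vᵢ mᵢ, integrated against `ρ`; the factor w is distributed over the
-- densities mᵢ ρ.
theorem spectralIntegral_recurrence (n : ℕ) (ρ : 𝓢(Plane, ℂ)) {v : ι → ℝ}
    (hv : v ∈ symbolCone m) :
    ∑ i, (v i : ℂ) * spectralIntegral m (n + 2) (mulSymbol (m i) ρ) v +
      (n + 1) * spectralIntegral m (n + 1) ρ v + spectralIntegral m n ρ v / 4 = 0 := by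
  have hi := fun (k : ℕ) (σ : 𝓢(Plane, ℂ)) => integrable_spectralIntegrand hm k σ hv
  simp only [spectralIntegral]
  simp_rw [← integral_const_mul]
  rw [← integral_div, ← integral_finsetSum _ fun i _ => (hi (n + 2) (mulSymbol (m i) ρ)).const_mul _,
    ← integral_add (integrable_finsetSum _ fun i _ =>
      (hi (n + 2) (mulSymbol (m i) ρ)).const_mul _) ((hi (n + 1) ρ).const_mul _)]
  refine (integral_add ((integrable_finsetSum _ fun i _ =>
      (hi (n + 2) (mulSymbol (m i) ρ)).const_mul _).add ((hi (n + 1) ρ).const_mul _))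
      ((hi n ρ).div_const _)).symm.trans ?_
  refine integral_eq_zero_of_ae (Eventually.of_forall fun ζ => ?_)
  have hr := congrArg (fun x : ℝ => (x : ℂ)) (besselEntire_recurrence n (∑ i, v i * m i ζ))
  simp only [mulSymbol_apply (hm _), Pi.zero_apply, Pi.add_apply]
  push_cast at hr ⊢
  have hs : ∑ i, (v i : ℂ) * ((besselEntire (n + 2) (∑ i, v i * m i ζ) : ℂ) * (m i ζ * ρ ζ)) =
      (∑ i, (v i : ℂ) * m i ζ) * (besselEntire (n + 2) (∑ i, v i * m i ζ) : ℂ) * ρ ζ := by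
    rw [Finset.sum_mul, Finset.sum_mul]
    exact Finset.sum_congr rfl fun i _ => by ring
  rw [hs]
  linear_combination ρ ζ * hr

end SpectralIntegral

/-! ### Bessel's integral and Sonine's convolution formula. -/

theorem _root_.HasSum.congr_terms {β : Type*} {R : Type*} [AddCommMonoid R] [TopologicalSpace R]
    {f g : β → R} {a : R} (h : HasSum f a)
    (hfg : ∀ b, f b = g b) : HasSum g a :=
  funext hfg ▸ h

theorem hasSum_besselEntire (n : ℕ) (w : ℝ) :
    HasSum (fun m : ℕ =>
      (-1 / 4 : ℝ) ^ (m + n) / (((m + n).factorial : ℝ) * (m.factorial : ℝ)) * w ^ m)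
      (besselEntire n w) :=
  (summable_besselEntire n w).hasSum

theorem integral_cos_pow_two_pi_even (m : ℕ) :
    ∫ θ in (0 : ℝ)..2 * Real.pi, Real.cos θ ^ (2 * m) =
      2 * Real.pi * ((2 * m).factorial / (4 ^ m * (m.factorial : ℝ) ^ 2)) := by
  induction m with
  | zero => simp
  | succ m ih =>
    rw [show 2 * (m + 1) = 2 * m + 2 by ring, integral_cos_pow, ih, Nat.factorial_succ (2 * m + 1),
      Nat.factorial_succ (2 * m), Nat.factorial_succ m]
    simp only [Real.sin_zero, Real.sin_two_pi]
    push_cast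
    field_simp
    ring

theorem integral_cos_pow_two_pi_odd (m : ℕ) :
    ∫ θ in (0 : ℝ)..2 * Real.pi, Real.cos θ ^ (2 * m + 1) = 0 := by
  induction m with
  | zero => simp
  | succ m ih =>
    rw [show 2 * (m + 1) + 1 = 2 * m + 1 + 2 by ring, integral_cos_pow, ih]
    simp

/-- Bessel's integral for `J₀`. -/
theorem integral_exp_cos (a : ℝ) :
    ∫ θ in (0 : ℝ)..2 * Real.pi, Complex.exp (Complex.I * (a * Real.cos θ : ℝ)) =
      2 * Real.pi * besselEntire 0 (a ^ 2) := by
  -- The exponential is expanded in powers of cos θ: the even moments produce the Bessel series and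
  -- the odd ones vanish.
  have h1 : HasSum (fun n : ℕ => ∫ θ in (0 : ℝ)..2 * Real.pi,
      ((Complex.I * a) ^ n / (n.factorial : ℂ)) * ((Real.cos θ ^ n : ℝ) : ℂ))
      (∫ θ in (0 : ℝ)..2 * Real.pi, Complex.exp (Complex.I * (a * Real.cos θ : ℝ))) := by
    refine intervalIntegral.hasSum_integral_of_dominated_convergence
      (fun n _ => |a| ^ n / (n.factorial : ℝ)) (fun n => ?_) (fun n => ?_) ?_ ?_ ?_
    · exact Continuous.aestronglyMeasurable (by fun_prop)
    · refine Eventually.of_forall fun θ _ => ?_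
      rw [norm_mul, norm_div, norm_pow, norm_mul, Complex.norm_I, one_mul, Complex.norm_real,
        Complex.norm_real, Complex.norm_natCast, Real.norm_eq_abs, Real.norm_eq_abs, abs_pow]
      exact mul_le_of_le_one_right (by positivity)
        (pow_le_one₀ (abs_nonneg _) (Real.abs_cos_le_one θ))
    · exact Eventually.of_forall fun _ _ => Real.summable_pow_div_factorial |a|
    · exact continuous_const.intervalIntegrable _ _
    · refine Eventually.of_forall fun θ _ => ?_
      rw [Complex.exp_eq_exp_ℂ]
      convert! NormedSpace.expSeries_div_hasSum_exp (Complex.I * (a * Real.cos θ : ℝ)) using 2 with n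
      push_cast
      ring
  have h2 : HasSum (fun m : ℕ => ∫ θ in (0 : ℝ)..2 * Real.pi,
      ((Complex.I * a) ^ (2 * m) / ((2 * m).factorial : ℂ)) * ((Real.cos θ ^ (2 * m) : ℝ) : ℂ))
      (2 * Real.pi * besselEntire 0 (a ^ 2)) := by
    have := (Complex.hasSum_ofReal.2 (hasSum_besselEntire 0 (a ^ 2))).mul_left (2 * Real.pi : ℂ)
    refine this.congr_terms fun m => ?_
    rw [intervalIntegral.integral_const_mul, intervalIntegral.integral_ofReal,
      integral_cos_pow_two_pi_even, mul_pow, pow_mul Complex.I, Complex.I_sq, add_zero, neg_div,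
      neg_pow (1 / 4 : ℝ), one_div_pow, pow_mul (a : ℂ)]
    have : ((2 * m).factorial : ℂ) ≠ 0 := by exact_mod_cast Nat.factorial_ne_zero _
    push_cast
    field_simp
  have h3 : HasSum (fun m : ℕ => ∫ θ in (0 : ℝ)..2 * Real.pi,
      ((Complex.I * a) ^ (2 * m + 1) / ((2 * m + 1).factorial : ℂ)) *
        ((Real.cos θ ^ (2 * m + 1) : ℝ) : ℂ)) 0 := by
    convert hasSum_zero with m
    rw [intervalIntegral.integral_const_mul, intervalIntegral.integral_ofReal,
      integral_cos_pow_two_pi_odd, Complex.ofReal_zero, mul_zero]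
  have h4 := h1.unique (HasSum.even_add_odd h2 h3)
  rw [h4, add_zero]

/-- Amplitude and phase: b cos θ + c sin θ = |z| cos(θ - arg z) with z = b + ic, and an integral
over a full period does not see the shift. -/
theorem integral_exp_cos_add_sin (b c t : ℝ) :
    ∫ θ in t..t + 2 * Real.pi, Complex.exp (Complex.I * (b * Real.cos θ + c * Real.sin θ : ℝ)) =
      2 * Real.pi * besselEntire 0 (b ^ 2 + c ^ 2) := by
  set z : ℂ := ⟨b, c⟩ with hz
  have hb : b = ‖z‖ * Real.cos z.arg := (Complex.norm_mul_cos_arg z).symm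
  have hc : c = ‖z‖ * Real.sin z.arg := (Complex.norm_mul_sin_arg z).symm
  have hper : Function.Periodic
      (fun θ : ℝ => Complex.exp (Complex.I * (‖z‖ * Real.cos θ : ℝ))) (2 * Real.pi) := fun θ => by
    simp only [Real.cos_add_two_pi]
  have hn : b ^ 2 + c ^ 2 = ‖z‖ ^ 2 := by
    rw [Complex.sq_norm, Complex.normSq_mk]
    ring
  rw [hn, ← integral_exp_cos, ← zero_add (2 * Real.pi),
    ← hper.intervalIntegral_add_eq (t - z.arg) 0, zero_add,
    show t - z.arg + 2 * Real.pi = t + 2 * Real.pi - z.arg by ring,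
    ← intervalIntegral.integral_comp_sub_right]
  refine intervalIntegral.integral_congr fun θ _ => ?_
  congr 3
  rw [Real.cos_sub, hb, hc]
  ring

/-- Euler's beta integral at integers, by parts in the exponent m. -/
theorem integral_pow_mul_sub_pow (s : ℝ) (m n : ℕ) :
    ∫ u in (0 : ℝ)..s, u ^ n * (s - u) ^ m =
      n.factorial * m.factorial / (n + m + 1).factorial * s ^ (n + m + 1) := by
  induction m generalizing n with
  | zero =>
    simp only [pow_zero, mul_one, integral_pow, add_zero, Nat.factorial_succ n, Nat.factorial_zero]
    push_cast
    field_simp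
    simp
  | succ m ih =>
    have hd : ∀ u ∈ uIcc 0 s, HasDerivAt (fun u : ℝ => u ^ (n + 1) * (s - u) ^ (m + 1))
        ((n + 1) * (u ^ n * (s - u) ^ (m + 1)) - (m + 1) * (u ^ (n + 1) * (s - u) ^ m)) u := by
      intro u _
      refine ((hasDerivAt_pow (n + 1) u).mul
        (((hasDerivAt_id u).const_sub s).pow (m + 1))).congr_deriv ?_
      simp
      ring
    have hi := intervalIntegral.integral_eq_sub_of_hasDerivAt hd
      (Continuous.intervalIntegrable (by fun_prop) _ _)
    rw [intervalIntegral.integral_sub (Continuous.intervalIntegrable (by fun_prop) _ _)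
      (Continuous.intervalIntegrable (by fun_prop) _ _), intervalIntegral.integral_const_mul,
      intervalIntegral.integral_const_mul, ih (n + 1)] at hi
    have hn : (n + 1 : ℝ) ≠ 0 := by positivity
    rw [show n + 1 + m + 1 = n + (m + 1) + 1 by ring] at hi
    apply mul_left_cancel₀ hn
    rw [sub_eq_iff_eq_add] at hi
    rw [hi, Nat.factorial_succ n, Nat.factorial_succ m]
    push_cast
    simp
    ring

theorem summable_double_factorial (x y s : ℝ) :
    Summable fun k : ℕ × ℕ => x ^ k.1 / k.1.factorial * (y ^ k.2 / k.2.factorial) *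
      (s ^ (k.1 + k.2) / (k.1 + k.2).factorial) := by
  have h1 := summable_mul_of_summable_norm (Real.summable_pow_div_factorial (x * s)).norm
    (Real.summable_pow_div_factorial (y * s)).norm
  refine Summable.of_norm_bounded h1.norm fun k => ?_
  have hf : (1 : ℝ) ≤ (k.1 + k.2).factorial := by
    exact_mod_cast Nat.succ_le_of_lt (Nat.factorial_pos _)
  have : x ^ k.1 / k.1.factorial * (y ^ k.2 / k.2.factorial) *
      (s ^ (k.1 + k.2) / (k.1 + k.2).factorial) =
      ((x * s) ^ k.1 / k.1.factorial * ((y * s) ^ k.2 / k.2.factorial)) /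
      (k.1 + k.2).factorial := by
    simp only [mul_pow, pow_add]
    ring
  rw [this, norm_div, Real.norm_natCast]
  exact div_le_self (norm_nonneg _) hf

/-- The binomial theorem on each antidiagonal expands (p + q)^N. Absolute convergence allows the
double series to be read by rows as well. -/
theorem hasSum_besselEntire_add (p q s : ℝ) :
    HasSum (fun k : ℕ × ℕ => (-q / 4) ^ k.1 / k.1.factorial * ((-p / 4) ^ k.2 / k.2.factorial) *
      (s ^ (k.1 + k.2) / (k.1 + k.2).factorial)) (besselEntire 0 ((p + q) * s)) := by
  have hsum := summable_double_factorial (-q / 4) (-p / 4) s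
  set x : ℝ := -q / 4 with hx
  set y : ℝ := -p / 4 with hy
  set F : ℕ × ℕ → ℝ := fun k => x ^ k.1 / k.1.factorial * (y ^ k.2 / k.2.factorial) *
    (s ^ (k.1 + k.2) / (k.1 + k.2).factorial) with hF
  have h1 : HasSum (fun N : ℕ => ∑ k ∈ Finset.HasAntidiagonal.antidiagonal N, F k)
      (∑' k, F k) := by
    have h2 := (Finset.HasAntidiagonal.sigmaAntidiagonalEquivProd (A := ℕ)).hasSum_iff.2
      hsum.hasSum
    refine (h2.sigma fun N => hasSum_fintype _).congr_terms fun N => ?_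
    exact Finset.sum_coe_sort (Finset.HasAntidiagonal.antidiagonal N) F
  have h3 : (fun N : ℕ => ∑ k ∈ Finset.HasAntidiagonal.antidiagonal N, F k) = fun N : ℕ =>
      (-1 / 4 : ℝ) ^ (N + 0) / (((N + 0).factorial : ℝ) * (N.factorial : ℝ)) *
        ((p + q) * s) ^ N := by
    funext N
    have h4 : (x + y) ^ N / N.factorial = ∑ k ∈ Finset.HasAntidiagonal.antidiagonal N,
        x ^ k.1 / k.1.factorial * (y ^ k.2 / k.2.factorial) := by
      rw [(Commute.all x y).add_pow', Finset.sum_div]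
      refine Finset.sum_congr rfl fun k hk => ?_
      rw [Finset.HasAntidiagonal.mem_antidiagonal] at hk
      rw [← hk, nsmul_eq_mul, Nat.cast_add_choose]
      field_simp
    have h5 : ∑ k ∈ Finset.HasAntidiagonal.antidiagonal N, F k =
        (∑ k ∈ Finset.HasAntidiagonal.antidiagonal N,
          x ^ k.1 / k.1.factorial * (y ^ k.2 / k.2.factorial)) * (s ^ N / N.factorial) := by
      rw [Finset.sum_mul]
      refine Finset.sum_congr rfl fun k hk => ?_
      rw [Finset.HasAntidiagonal.mem_antidiagonal] at hk
      simp only [hF, hk]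
    rw [h5, ← h4, show x + y = (-1 / 4) * (p + q) by rw [hx, hy]; ring, add_zero, mul_pow, mul_pow]
    ring
  rw [h3] at h1
  rw [(hasSum_besselEntire 0 ((p + q) * s)).unique h1]
  exact hsum.hasSum

theorem hasSum_integral_besselEntire_mul (p q s : ℝ) :
    HasSum (fun k : ℕ × ℕ => ∫ u in (0 : ℝ)..s,
        ((-1 / 4 : ℝ) ^ (k.1 + 1) / (((k.1 + 1).factorial : ℝ) * (k.1.factorial : ℝ)) *
            (q * (s - u)) ^ k.1) *
          ((-1 / 4 : ℝ) ^ (k.2 + 0) / (((k.2 + 0).factorial : ℝ) * (k.2.factorial : ℝ)) *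
            (p * u) ^ k.2))
        (∫ u in (0 : ℝ)..s, besselEntire 1 (q * (s - u)) * besselEntire 0 (p * u)) := by
  have hb : Summable fun k : ℕ × ℕ => (|q * s| ^ k.1 / k.1.factorial) *
      (|p * s| ^ k.2 / k.2.factorial) :=
    summable_mul_of_summable_norm (Real.summable_pow_div_factorial |q * s|).norm
      (Real.summable_pow_div_factorial |p * s|).norm
  refine intervalIntegral.hasSum_integral_of_dominated_convergence
    (fun k _ => (|q * s| ^ k.1 / k.1.factorial) * (|p * s| ^ k.2 / k.2.factorial))
    (fun k => Continuous.aestronglyMeasurable (by fun_prop)) (fun k => ?_)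
    (Eventually.of_forall fun _ _ => hb) (continuous_const.intervalIntegrable _ _) ?_
  · refine Eventually.of_forall fun u hu => ?_
    have hu1 : |u| ≤ |s| ∧ |s - u| ≤ |s| := by
      rcases le_total 0 s with h | h
      · rw [uIoc_of_le h] at hu
        rw [abs_of_nonneg h, abs_of_pos hu.1, abs_of_nonneg (by linarith [hu.2])]
        exact ⟨hu.2, by linarith [hu.1]⟩
      · rw [uIoc_of_ge h] at hu
        rw [abs_of_nonpos h, abs_of_nonpos hu.2, abs_of_nonpos (by linarith [hu.1])]
        exact ⟨by linarith [hu.1], by linarith [hu.2]⟩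
    have h1 : |q * (s - u)| ≤ |q * s| := by
      rw [abs_mul, abs_mul]
      exact mul_le_mul_of_nonneg_left hu1.2 (abs_nonneg q)
    have h2 : |p * u| ≤ |p * s| := by
      rw [abs_mul, abs_mul]
      exact mul_le_mul_of_nonneg_left hu1.1 (abs_nonneg p)
    rw [norm_mul]
    refine mul_le_mul ((norm_besselEntire_term_le 1 k.1 _).trans ?_)
      ((norm_besselEntire_term_le 0 k.2 _).trans ?_) (norm_nonneg _) (by positivity)
    · gcongr
    · gcongr
  · refine Eventually.of_forall fun u _ => ?_
    have hm := summable_mul_of_summable_norm (summable_besselEntire 1 (q * (s - u))).norm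
      (summable_besselEntire 0 (p * u)).norm
    have h := (hasSum_besselEntire 1 (q * (s - u))).mul (hasSum_besselEntire 0 (p * u)) hm
    exact h

/-- Sonine's convolution formula for `J₀` and `J₁`. -/
theorem besselEntire_convolution (p q s : ℝ) :
    besselEntire 0 (p * s) +
      q * ∫ u in (0 : ℝ)..s, besselEntire 1 (q * (s - u)) * besselEntire 0 (p * u) =
      besselEntire 0 ((p + q) * s) := by
  set x : ℝ := -q / 4 with hx
  set y : ℝ := -p / 4 with hy
  set F : ℕ × ℕ → ℝ := fun k => x ^ k.1 / k.1.factorial * (y ^ k.2 / k.2.factorial) *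
    (s ^ (k.1 + k.2) / (k.1 + k.2).factorial) with hF
  have hsum : Summable F := summable_double_factorial x y s
  have htot : HasSum F (besselEntire 0 ((p + q) * s)) := hasSum_besselEntire_add p q s
  -- The rows with first index at least 1 make up the integral: the beta integral supplies the
  -- missing factorials.
  have hint : HasSum (fun k : ℕ × ℕ => F (k.1 + 1, k.2))
      (q * ∫ u in (0 : ℝ)..s, besselEntire 1 (q * (s - u)) * besselEntire 0 (p * u)) := by
    refine ((hasSum_integral_besselEntire_mul p q s).mul_left q).congr_terms fun k => ?_
    have h2 : ∀ u : ℝ, ((-1 / 4 : ℝ) ^ (k.1 + 1) / (((k.1 + 1).factorial : ℝ) * (k.1.factorial : ℝ)) *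
            (q * (s - u)) ^ k.1) *
          ((-1 / 4 : ℝ) ^ (k.2 + 0) / (((k.2 + 0).factorial : ℝ) * (k.2.factorial : ℝ)) *
            (p * u) ^ k.2) =
        ((-1 / 4 : ℝ) ^ (k.1 + 1) / (((k.1 + 1).factorial : ℝ) * (k.1.factorial : ℝ)) * q ^ k.1 *
          ((-1 / 4 : ℝ) ^ k.2 / ((k.2.factorial : ℝ) * (k.2.factorial : ℝ)) * p ^ k.2)) *
          (u ^ k.2 * (s - u) ^ k.1) := fun u => by
      rw [mul_pow, mul_pow, add_zero]
      ring
    simp_rw [h2]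
    rw [intervalIntegral.integral_const_mul, integral_pow_mul_sub_pow]
    simp only [hF]
    rw [show x = (-1 / 4) * q by rw [hx]; ring, show y = (-1 / 4) * p by rw [hy]; ring, mul_pow,
      mul_pow, show k.2 + k.1 + 1 = k.1 + 1 + k.2 by ring,
      pow_succ q]
    field_simp
  -- The row with first index 0 is the Bessel function without q.
  have hfst : HasSum (fun n : ℕ => F (0, n)) (besselEntire 0 (p * s)) := by
    refine (hasSum_besselEntire 0 (p * s)).congr_terms fun n => ?_
    simp only [hF]
    rw [show y = (-1 / 4) * p by rw [hy]; ring, mul_pow, mul_pow, add_zero, zero_add]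
    simp
    field_simp
  rw [← htot.tsum_eq, ← hint.tsum_eq, ← hfst.tsum_eq, hsum.tsum_prod,
    hint.summable.tsum_prod, hsum.prod.tsum_eq_zero_add]

/-! ### Fourier transform of the free-field solution. -/

/-- The plane wave `x ↦ exp (-2πi ζ·x)`. -/
def planeWave (ζ x : Plane) : ℂ := Complex.exp (Complex.I * (-(2 * Real.pi * inner ℝ ζ x) : ℝ))

theorem norm_planeWave (ζ x : Plane) : ‖planeWave ζ x‖ = 1 := by
  rw [planeWave, mul_comm, Complex.norm_exp_ofReal_mul_I]

theorem fourier_eq_integral_planeWave (ρ : 𝓢(Plane, ℂ)) (x : Plane) :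
    𝓕 ρ x = ∫ ζ, ρ ζ * planeWave ζ x := by
  rw [SchwartzMap.fourier_coe, Real.fourier_eq']
  refine integral_congr_ae (Eventually.of_forall fun ζ => ?_)
  simp only [smul_eq_mul, planeWave]
  rw [mul_comm, mul_comm Complex.I]
  congr 4
  ring

/-- Fubini, in a form that covers both parts of the free solution: arc measure transported to the
circle (g = 1) and the mass term as a density on the plane. -/
theorem integral_fourier_comp_mul {α : Type*} [MeasurableSpace α] {ν : Measure α} [SFinite ν]
    {X : α → Plane} (hX : Measurable X) {g : α → ℂ} (hg : Integrable g ν) (ρ : 𝓢(Plane, ℂ)) :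
    ∫ a, 𝓕 ρ (X a) * g a ∂ν = ∫ ζ, ρ ζ * (∫ a, planeWave ζ (X a) * g a ∂ν) := by
  have hint : Integrable (Function.uncurry fun (a : α) (ζ : Plane) =>
      planeWave ζ (X a) * (g a * ρ ζ)) (ν.prod volume) := by
    refine Integrable.bdd_mul (hg.mul_prod ρ.integrable) (c := 1) ?_
      (Eventually.of_forall fun p => (norm_planeWave _ _).le)
    have : Measurable fun p : α × Plane => planeWave p.2 (X p.1) := by
      unfold planeWave
      fun_prop
    exact this.aestronglyMeasurable
  calc ∫ a, 𝓕 ρ (X a) * g a ∂ν = ∫ a, (∫ ζ, planeWave ζ (X a) * (g a * ρ ζ)) ∂ν := by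
        refine integral_congr_ae (Eventually.of_forall fun a => ?_)
        simp only [fourier_eq_integral_planeWave]
        rw [← integral_mul_const]
        refine integral_congr_ae (Eventually.of_forall fun ζ => ?_)
        simp only
        ring
    _ = ∫ ζ, (∫ a, planeWave ζ (X a) * (g a * ρ ζ) ∂ν) := integral_integral_swap hint
    _ = _ := by
        refine integral_congr_ae (Eventually.of_forall fun ζ => ?_)
        simp only
        rw [← integral_const_mul]
        refine integral_congr_ae (Eventually.of_forall fun a => ?_)
        simp only
        ring

theorem planeWave_polar (ζ : Plane) (r θ : ℝ) :
    planeWave ζ !₂[r * Real.cos θ, r * Real.sin θ] =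
      Complex.exp (Complex.I * (-(2 * Real.pi * r * ζ 0) * Real.cos θ +
        -(2 * Real.pi * r * ζ 1) * Real.sin θ : ℝ)) := by
  rw [planeWave]
  congr 3
  simp [PiLp.inner_apply, Fin.sum_univ_two]
  ring

theorem integral_planeWave_circle (ζ : Plane) (r t : ℝ) :
    ∫ θ in t..t + 2 * Real.pi, planeWave ζ !₂[r * Real.cos θ, r * Real.sin θ] =
      2 * Real.pi * besselEntire 0 ((2 * Real.pi) ^ 2 * ‖ζ‖ ^ 2 * r ^ 2) := by
  simp_rw [planeWave_polar]
  rw [integral_exp_cos_add_sin, EuclideanSpace.real_norm_sq_eq, Fin.sum_univ_two]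
  congr 3
  ring

theorem integral_plane_eq_prod (f : Plane → ℂ) :
    ∫ x, f x = ∫ p : ℝ × ℝ, f !₂[p.1, p.2] := by
  have h1 := ((PiLp.volume_preserving_toLp (Fin 2)).integral_comp
    (MeasurableEquiv.toLp 2 (Fin 2 → ℝ)).measurableEmbedding f).symm
  rw [h1]
  exact ((volume_preserving_finTwoArrow ℝ).symm.integral_comp'
    (fun y => f (WithLp.toLp 2 y))).symm

theorem integral_plane_polar (f : Plane → ℂ) :
    ∫ x, f x = ∫ p in Ioi (0 : ℝ) ×ˢ Ioo (-Real.pi) Real.pi,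
      (p.1 : ℂ) * f !₂[p.1 * Real.cos p.2, p.1 * Real.sin p.2] := by
  rw [integral_plane_eq_prod, ← integral_comp_polarCoord_symm]
  refine integral_congr_ae (Eventually.of_forall fun p => ?_)
  simp [polarCoord]

theorem norm_polar (r θ : ℝ) :
    ‖(!₂[r * Real.cos θ, r * Real.sin θ] : Plane)‖ ^ 2 = r ^ 2 := by
  rw [EuclideanSpace.real_norm_sq_eq, Fin.sum_univ_two]
  simp only [Matrix.cons_val_zero, Matrix.cons_val_one]
  linear_combination r ^ 2 * Real.cos_sq_add_sin_sq θ

theorem integrable_massiveTerm (κ s : ℝ) : Integrable (massiveTerm κ s) :=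
  memLp_one_iff_integrable.1 (memLp_massiveTerm κ s)

/-- The radial profile of `θ(λ²) J₁(κλ)/λ`. -/
theorem massiveTerm_polar (κ s r θ : ℝ) :
    massiveTerm κ s !₂[r * Real.cos θ, r * Real.sin θ] =
      if r ^ 2 < s then ((-2 * κ * besselEntire 1 (κ ^ 2 * (s - r ^ 2)) : ℝ) : ℂ) else 0 := by
  rw [massiveTerm, norm_polar]
  split_ifs with h
  · rw [besselJ_one_div_sqrt κ (sub_pos.2 h)]
  · rfl

/-- In polar coordinates the angular integral is Bessel's integral, and u = r² turns the radial one
into the convolution of Sonine's formula. -/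
theorem integral_planeWave_massiveTerm (κ : ℝ) {s : ℝ} (hs : 0 ≤ s) (ζ : Plane) :
    ∫ x, planeWave ζ x * massiveTerm κ s x =
      ((-2 * κ * Real.pi * ∫ u in (0 : ℝ)..s, besselEntire 1 (κ ^ 2 * (s - u)) *
        besselEntire 0 ((2 * Real.pi) ^ 2 * ‖ζ‖ ^ 2 * u) : ℝ) : ℂ) := by
  set g : ℝ → ℂ := fun r =>
    if r ^ 2 < s then ((-2 * κ * besselEntire 1 (κ ^ 2 * (s - r ^ 2)) : ℝ) : ℂ) else 0 with hg
  have hgm : Measurable g := by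
    refine Measurable.ite (measurableSet_lt (by fun_prop) measurable_const) ?_ measurable_const
    have := (continuous_besselEntire 1).measurable
    fun_prop
  have hpm : Measurable fun p : ℝ × ℝ =>
      planeWave ζ !₂[p.1 * Real.cos p.2, p.1 * Real.sin p.2] := by
    simp_rw [planeWave_polar]
    fun_prop
  have hint : IntegrableOn (fun p : ℝ × ℝ => (p.1 : ℂ) *
      (planeWave ζ !₂[p.1 * Real.cos p.2, p.1 * Real.sin p.2] * g p.1))
      (Ioi (0 : ℝ) ×ˢ Ioo (-Real.pi) Real.pi) := by
    rw [← inter_univ (Ioi (0 : ℝ) ×ˢ Ioo (-Real.pi) Real.pi)]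
    have hsub : IntegrableOn (fun p : ℝ × ℝ => (p.1 : ℂ) *
        (planeWave ζ !₂[p.1 * Real.cos p.2, p.1 * Real.sin p.2] * g p.1))
        (Ioc (0 : ℝ) √s ×ˢ Ioo (-Real.pi) Real.pi) := by
      refine Measure.integrableOn_of_bounded (M := √s * (|κ| / 2 * Real.exp (κ ^ 2 * s / 4)))
        ?_ (by fun_prop) ?_
      · rw [Measure.volume_eq_prod, Measure.prod_prod]
        simp [ENNReal.mul_eq_top]
      · refine (ae_restrict_iff' (measurableSet_Ioc.prod measurableSet_Ioo)).2
          (Eventually.of_forall fun p hp => ?_)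
        rw [norm_mul, norm_mul, norm_planeWave, one_mul, Complex.norm_real, Real.norm_eq_abs,
          abs_of_pos hp.1.1, hg]
        simp only
        rw [← massiveTerm_polar κ s p.1 p.2]
        gcongr
        · exact hp.1.2
        · exact norm_massiveTerm_le _ _ _
    refine hsub.of_forall_sdiff_eq_zero ((measurableSet_Ioi.prod measurableSet_Ioo).inter .univ)
      fun p hp => ?_
    have h1 : ¬ p.1 ^ 2 < s := by
      intro h
      apply hp.2
      exact ⟨⟨hp.1.1.1, Real.le_sqrt_of_sq_le h.le⟩, hp.1.1.2⟩
    simp [hg, h1]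
  have hrad : ∀ r : ℝ, ∫ θ in Ioo (-Real.pi) Real.pi, (r : ℂ) *
      (planeWave ζ !₂[r * Real.cos θ, r * Real.sin θ] * g r) =
      (r : ℂ) * g r * (2 * Real.pi * besselEntire 0 ((2 * Real.pi) ^ 2 * ‖ζ‖ ^ 2 * r ^ 2)) := by
    intro r
    have h := integral_planeWave_circle ζ r (-Real.pi)
    rw [show -Real.pi + 2 * Real.pi = Real.pi by ring,
      intervalIntegral.integral_of_le (by linarith [Real.pi_pos]),
      integral_Ioc_eq_integral_Ioo] at h
    rw [← h, ← integral_const_mul]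
    refine integral_congr_ae (Eventually.of_forall fun θ => ?_)
    simp only
    ring
  -- Substitution u = r².
  have hsq : ∫ u in (0 : ℝ)..s, besselEntire 1 (κ ^ 2 * (s - u)) *
        besselEntire 0 ((2 * Real.pi) ^ 2 * ‖ζ‖ ^ 2 * u) =
      ∫ r in (0 : ℝ)..√s, (besselEntire 1 (κ ^ 2 * (s - r ^ 2)) *
        besselEntire 0 ((2 * Real.pi) ^ 2 * ‖ζ‖ ^ 2 * r ^ 2)) * (2 * r) := by
    have h := intervalIntegral.integral_comp_mul_deriv (a := 0) (b := √s)
      (f := fun r : ℝ => r ^ 2) (f' := fun r : ℝ => 2 * r)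
      (g := fun u => besselEntire 1 (κ ^ 2 * (s - u)) *
        besselEntire 0 ((2 * Real.pi) ^ 2 * ‖ζ‖ ^ 2 * u))
      (fun r _ => by simpa using hasDerivAt_pow 2 r) (by fun_prop) (by
        have := continuous_besselEntire 1
        have := continuous_besselEntire 0
        fun_prop)
    rw [Real.sq_sqrt hs] at h
    simp only [Function.comp_apply, ne_eq, OfNat.ofNat_ne_zero, not_false_eq_true, zero_pow] at h
    exact h.symm
  rw [integral_plane_polar, Measure.volume_eq_prod]
  simp_rw [massiveTerm_polar]
  rw [setIntegral_prod _ hint]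
  simp_rw [hrad]
  have hzero : ∫ r in Ioi (0 : ℝ), (r : ℂ) * g r *
      (2 * Real.pi * besselEntire 0 ((2 * Real.pi) ^ 2 * ‖ζ‖ ^ 2 * r ^ 2)) =
      ∫ r in Ioo (0 : ℝ) √s, (r : ℂ) * g r *
      (2 * Real.pi * besselEntire 0 ((2 * Real.pi) ^ 2 * ‖ζ‖ ^ 2 * r ^ 2)) := by
    refine setIntegral_eq_of_subset_of_forall_sdiff_eq_zero measurableSet_Ioi
      (fun r hr => hr.1) fun r hr => ?_
    have h1 : ¬ r ^ 2 < s := fun h => hr.2 ⟨hr.1, Real.lt_sqrt_of_sq_lt h⟩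
    simp [hg, h1]
  rw [hzero, hsq, ← intervalIntegral.integral_const_mul, ← intervalIntegral.integral_ofReal,
    intervalIntegral.integral_of_le (Real.sqrt_nonneg s), integral_Ioc_eq_integral_Ioo]
  refine setIntegral_congr_fun measurableSet_Ioo fun r hr => ?_
  have h1 : r ^ 2 < s := (Real.lt_sqrt hr.1.le).1 hr.2
  simp only [hg, if_pos h1]
  push_cast
  ring

/-- The Fourier representation of the free-field solution. -/
theorem freeSolution_fourier (κ : ℝ) {s : ℝ} (hs : 0 ≤ s) (ρ : 𝓢(Plane, ℂ)) :
    freeSolution κ s (𝓕 ρ) =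
      ∫ ζ, (besselEntire 0 (s * ((2 * Real.pi) ^ 2 * ‖ζ‖ ^ 2 + κ ^ 2)) : ℂ) * ρ ζ := by
  have hmeas : Measurable fun θ : ℝ => (!₂[√s * Real.cos θ, √s * Real.sin θ] : Plane) := by
    fun_prop
  have hdelta : deltaInterval s (𝓕 ρ) =
      ∫ ζ, ρ ζ * (Real.pi * besselEntire 0 ((2 * Real.pi) ^ 2 * ‖ζ‖ ^ 2 * s)) := by
    have h1 : deltaInterval s (𝓕 ρ) = (1 / 2 : ℂ) * ∫ x : Plane, 𝓕 ρ x
        ∂((volume.restrict (Ioc 0 (2 * Real.pi))).map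
          (fun θ : ℝ => (!₂[√s * Real.cos θ, √s * Real.sin θ] : Plane))) := rfl
    have h2 := integral_fourier_comp_mul (ν := volume.restrict (Ioc 0 (2 * Real.pi))) hmeas
      (g := fun _ => 1) (integrable_const _) ρ
    simp only [mul_one] at h2
    rw [h1, integral_map hmeas.aemeasurable (𝓕 ρ).continuous.aestronglyMeasurable, h2,
      ← integral_const_mul]
    refine integral_congr_ae (Eventually.of_forall fun ζ => ?_)
    have h3 := integral_planeWave_circle ζ √s 0
    rw [zero_add, intervalIntegral.integral_of_le (by positivity), Real.sq_sqrt hs] at h3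
    simp only [h3]
    ring
  have hmass : massiveDistribution κ s (𝓕 ρ) = ∫ ζ, ρ ζ *
      ((-2 * κ * Real.pi * ∫ u in (0 : ℝ)..s, besselEntire 1 (κ ^ 2 * (s - u)) *
        besselEntire 0 ((2 * Real.pi) ^ 2 * ‖ζ‖ ^ 2 * u) : ℝ) : ℂ) := by
    simp_rw [← integral_planeWave_massiveTerm κ hs]
    have h2 := integral_fourier_comp_mul measurable_id (integrable_massiveTerm κ s) ρ
    simp only [id] at h2
    rw [← h2, massiveDistribution, Lp.toTemperedDistribution_apply]
    refine integral_congr_ae ?_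
    filter_upwards [(memLp_massiveTerm κ s).coeFn_toLp] with x hx
    rw [hx, smul_eq_mul]
  have happ : freeSolution κ s (𝓕 ρ) = (1 / Real.pi : ℂ) *
      (deltaInterval s (𝓕 ρ) - (κ / 2 : ℂ) * massiveDistribution κ s (𝓕 ρ)) := rfl
  have hj := continuous_besselEntire 0
  have hi1 : Integrable fun ζ => ρ ζ *
      (Real.pi * besselEntire 0 ((2 * Real.pi) ^ 2 * ‖ζ‖ ^ 2 * s) : ℂ) := by
    refine ρ.integrable.mul_bdd (c := Real.pi) (Continuous.aestronglyMeasurable (by fun_prop))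
      (Eventually.of_forall fun ζ => ?_)
    rw [norm_mul, Complex.norm_real, Complex.norm_real, Real.norm_eq_abs, Real.norm_eq_abs,
      abs_of_pos Real.pi_pos]
    exact mul_le_of_le_one_right Real.pi_pos.le (abs_besselEntire_le_one 0 (by positivity))
  have hi2 : Integrable fun ζ => (besselEntire 0 (s * ((2 * Real.pi) ^ 2 * ‖ζ‖ ^ 2 + κ ^ 2)) : ℂ) *
      ρ ζ := by
    refine ρ.integrable.bdd_mul (c := 1) (Continuous.aestronglyMeasurable (by fun_prop))
      (Eventually.of_forall fun ζ => ?_)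
    rw [Complex.norm_real, Real.norm_eq_abs]
    exact abs_besselEntire_le_one 0 (by positivity)
  have hpi : (Real.pi : ℂ) ≠ 0 := by exact_mod_cast Real.pi_ne_zero
  -- Sonine's formula with p = (2π|ζ|)² and q = κ²: the mass term is exactly what replaces p by p +
  -- κ² in the transform of the circle.
  have hconv : ∀ ζ : Plane, κ * κ * ((∫ u in (0 : ℝ)..s, besselEntire 1 (κ ^ 2 * (s - u)) *
        besselEntire 0 ((2 * Real.pi) ^ 2 * ‖ζ‖ ^ 2 * u) : ℝ) : ℂ) =
      besselEntire 0 (s * ((2 * Real.pi) ^ 2 * ‖ζ‖ ^ 2 + κ ^ 2)) -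
        besselEntire 0 ((2 * Real.pi) ^ 2 * ‖ζ‖ ^ 2 * s) := by
    intro ζ
    have h := besselEntire_convolution ((2 * Real.pi) ^ 2 * ‖ζ‖ ^ 2) (κ ^ 2) s
    rw [mul_comm ((2 * Real.pi) ^ 2 * ‖ζ‖ ^ 2 + κ ^ 2) s] at h
    rw [← h]
    push_cast
    ring
  have hmass' : (κ / 2 : ℂ) * massiveDistribution κ s (𝓕 ρ) =
      -(Real.pi * ∫ ζ, (besselEntire 0 (s * ((2 * Real.pi) ^ 2 * ‖ζ‖ ^ 2 + κ ^ 2)) : ℂ) * ρ ζ) +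
        deltaInterval s (𝓕 ρ) := by
    rw [hmass, hdelta, ← integral_const_mul, ← integral_const_mul, ← integral_neg]
    refine Eq.trans ?_ (integral_add (hi2.const_mul _).neg hi1)
    refine integral_congr_ae (Eventually.of_forall fun ζ => ?_)
    have h := hconv ζ
    simp only
    push_cast at h ⊢
    linear_combination (-(Real.pi : ℂ) * ρ ζ) * h
  rw [happ, hmass']
  field_simp
  ring

/-! ### The phase, the symbols of K² and the effective mass. -/

theorem iteratedDeriv_exp_I_mul (n : ℕ) :
    iteratedDeriv n (fun t : ℝ => Complex.exp (Complex.I * t)) =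
      fun t : ℝ => Complex.I ^ n * Complex.exp (Complex.I * t) := by
  induction n with
  | zero => simp
  | succ n ih =>
    rw [iteratedDeriv_succ, ih]
    funext t
    have h : HasDerivAt (fun t : ℝ => Complex.I * (t : ℂ)) (Complex.I * 1) t :=
      (Complex.ofRealCLM.hasDerivAt (x := t)).const_mul Complex.I
    rw [(h.cexp.const_mul (Complex.I ^ n)).deriv]
    ring

theorem hasTemperateGrowth_exp_I_mul :
    Function.HasTemperateGrowth fun t : ℝ => Complex.exp (Complex.I * t) := by
  refine ⟨(contDiff_const.mul Complex.ofRealCLM.contDiff).cexp, fun n => ⟨0, 1, fun t => ?_⟩⟩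
  rw [norm_iteratedFDeriv_eq_norm_iteratedDeriv, iteratedDeriv_exp_I_mul, norm_mul, norm_pow,
    Complex.norm_I, one_pow, mul_comm Complex.I, Complex.norm_exp_ofReal_mul_I]
  simp

theorem phase_eq (e ħ c : ℝ) (A : ℝ → Plane) (ξ : ℝ) (x : Plane) :
    phase e ħ c A ξ x =
      Complex.exp (Complex.I * (inner ℝ x (-((e / (ħ * c)) • average A ξ)) : ℝ)) := by
  rw [phase, inner_neg_right, inner_smul_right]
  congr 1
  push_cast
  ring

/-- Guarantees that multiplying a Schwartz function by the phase is pointwise multiplication. -/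
theorem hasTemperateGrowth_phase (e ħ c : ℝ) (A : ℝ → Plane) (ξ : ℝ) :
    (phase e ħ c A ξ).HasTemperateGrowth := by
  rw [funext (phase_eq e ħ c A ξ)]
  exact hasTemperateGrowth_exp_I_mul.comp (by fun_prop)

/-- The inverse Fourier transform turns the phase into a translation. -/
theorem fourierInv_phase_mul (e ħ c : ℝ) (A : ℝ → Plane) (ξ : ℝ) (φ : 𝓢(Plane, ℂ)) (ζ : Plane) :
    𝓕⁻ (SchwartzMap.smulLeftCLM ℂ (phase e ħ c A ξ) φ) ζ =
      𝓕⁻ φ (ζ - (2 * Real.pi)⁻¹ • ((e / (ħ * c)) • average A ξ)) := by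
  rw [SchwartzMap.fourierInv_coe, SchwartzMap.fourierInv_coe, Real.fourierInv_eq',
    Real.fourierInv_eq']
  refine integral_congr_ae (Eventually.of_forall fun x => ?_)
  simp only
  rw [SchwartzMap.smulLeftCLM_apply_apply (hasTemperateGrowth_phase e ħ c A ξ), phase_eq,
    smul_eq_mul, smul_eq_mul, smul_eq_mul, ← mul_assoc, ← Complex.exp_add, inner_sub_right,
    inner_smul_right _ _ (2 * Real.pi)⁻¹, inner_neg_right]
  congr 2
  have hpi : (Real.pi : ℂ) ≠ 0 := by exact_mod_cast Real.pi_ne_zero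
  push_cast
  field_simp
  ring

/-- The functions of the momentum `2πζ` whose combinations are the parameters `K²`. -/
def symbol : Fin 4 → Plane → ℝ :=
  ![fun ζ => (2 * Real.pi) ^ 2 * ‖ζ‖ ^ 2, fun ζ => 2 * Real.pi * ζ 0,
    fun ζ => 2 * Real.pi * ζ 1, fun _ => 1]

/-- The coefficients of `K²` for the value `a` of the potential. -/
def symbolCoeff (e ħ c k₀ : ℝ) (a : Plane) : Fin 4 → ℝ :=
  ![1, 2 * e / (ħ * c) * a 0, 2 * e / (ħ * c) * a 1, k₀ ^ 2 + e ^ 2 / (ħ ^ 2 * c ^ 2) * ‖a‖ ^ 2]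

theorem hasTemperateGrowth_symbol (i : Fin 4) : (symbol i).HasTemperateGrowth := by
  have h0 := Function.hasTemperateGrowth_norm_sq (H := Plane)
  have h1 : ∀ j : Fin 2, Function.HasTemperateGrowth fun ζ : Plane => ζ j := fun j =>
    (EuclideanSpace.proj (𝕜 := ℝ) j).hasTemperateGrowth
  fin_cases i
  · exact (Function.HasTemperateGrowth.const _).mul h0
  · exact (Function.HasTemperateGrowth.const _).mul (h1 0)
  · exact (Function.HasTemperateGrowth.const _).mul (h1 1)
  · exact Function.HasTemperateGrowth.const _

theorem abs_symbol_le (i : Fin 4) (ζ : Plane) :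
    |symbol i ζ| ≤ (2 * Real.pi) ^ 2 * (1 + ‖ζ‖ ^ 2) := by
  have hpi : 1 ≤ 2 * Real.pi := by linarith [Real.pi_gt_three]
  have hpi2 : 2 * Real.pi ≤ (2 * Real.pi) ^ 2 := by nlinarith
  have hcoord : ∀ j : Fin 2, |2 * Real.pi * ζ j| ≤ (2 * Real.pi) ^ 2 * (1 + ‖ζ‖ ^ 2) := by
    intro j
    have hj : |ζ j| ≤ ‖ζ‖ := by simpa using PiLp.norm_apply_le ζ j
    rw [abs_mul, abs_of_pos (by positivity : 0 < 2 * Real.pi)]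
    have : |ζ j| ≤ 1 + ‖ζ‖ ^ 2 := by nlinarith [sq_nonneg (‖ζ‖ - 1)]
    exact mul_le_mul hpi2 this (abs_nonneg _) (by positivity)
  fin_cases i
  · change |(2 * Real.pi) ^ 2 * ‖ζ‖ ^ 2| ≤ _
    rw [abs_of_nonneg (by positivity)]
    gcongr
    linarith
  · exact hcoord 0
  · exact hcoord 1
  · change |(1 : ℝ)| ≤ _
    rw [abs_one]
    nlinarith [sq_nonneg ‖ζ‖, mul_nonneg (sq_nonneg (2 * Real.pi)) (sq_nonneg ‖ζ‖)]

/-- Every symbol is dominated by 1 + |ζ|², so a combination that is coercive at that rate stays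
nonnegative under small changes of its coefficients. -/
theorem mem_interior_symbolCone {v : Fin 4 → ℝ} {ε : ℝ} (hε : 0 < ε)
    (hv : ∀ ζ : Plane, ε * (1 + ‖ζ‖ ^ 2) ≤ ∑ i, v i * symbol i ζ) :
    v ∈ interior (symbolCone symbol) := by
  rw [mem_interior_iff_mem_nhds, Metric.mem_nhds_iff]
  -- With this radius each of the four symbols costs at most a quarter of the margin ε (1 + |ζ|²).
  refine ⟨ε / (4 * (2 * Real.pi) ^ 2), by positivity, fun w hw ζ => ?_⟩
  rw [mem_ball_iff_norm] at hw
  have h1 : ∀ i, -(ε / 4 * (1 + ‖ζ‖ ^ 2)) ≤ (w i - v i) * symbol i ζ := by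
    intro i
    have h2 : |w i - v i| ≤ ε / (4 * (2 * Real.pi) ^ 2) :=
      (norm_le_pi_norm (w - v) i).trans hw.le
    have h3 : |(w i - v i) * symbol i ζ| ≤ ε / (4 * (2 * Real.pi) ^ 2) *
        ((2 * Real.pi) ^ 2 * (1 + ‖ζ‖ ^ 2)) := by
      rw [abs_mul]
      exact mul_le_mul h2 (abs_symbol_le i ζ) (abs_nonneg _) (by positivity)
    have h4 : ε / (4 * (2 * Real.pi) ^ 2) * ((2 * Real.pi) ^ 2 * (1 + ‖ζ‖ ^ 2)) =
        ε / 4 * (1 + ‖ζ‖ ^ 2) := by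
      field_simp
    rw [h4] at h3
    exact (abs_le.1 h3).1
  have h5 : ∑ i, w i * symbol i ζ = ∑ i, v i * symbol i ζ + ∑ i, (w i - v i) * symbol i ζ := by
    rw [← Finset.sum_add_distrib]
    exact Finset.sum_congr rfl fun i _ => by ring
  have h6 : ∑ _i : Fin 4, -(ε / 4 * (1 + ‖ζ‖ ^ 2)) ≤ ∑ i, (w i - v i) * symbol i ζ :=
    Finset.sum_le_sum fun i _ => h1 i
  rw [Finset.sum_const, Finset.card_univ, Fintype.card_fin, nsmul_eq_mul] at h6
  rw [h5]
  have := hv ζ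
  push_cast at h6
  linarith

theorem sum_symbolCoeff_mul_symbol (e ħ c k₀ : ℝ) (A : ℝ → Plane) (ξ : ℝ) (ζ : Plane) :
    ∑ i, symbolCoeff e ħ c k₀ (A ξ) i * symbol i ζ =
      momentumParameter e ħ c k₀ A ((2 * Real.pi) • ζ) ξ := by
  rw [momentumParameter, Fin.sum_univ_four, norm_smul, inner_smul_right, mul_pow, Real.norm_eq_abs,
    sq_abs]
  simp [symbolCoeff, symbol, PiLp.inner_apply, Fin.sum_univ_two]
  ring

theorem continuous_symbolCoeff (e ħ c k₀ : ℝ) : Continuous (symbolCoeff e ħ c k₀) := by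
  refine continuous_pi fun i => ?_
  fin_cases i <;> simp [symbolCoeff] <;> fun_prop

/-- The primitive `∫₀^ξ` of the coefficients of `K²` along the potential. -/
def symbolPrimitive (e ħ c k₀ : ℝ) (A : ℝ → Plane) (ξ : ℝ) : Fin 4 → ℝ :=
  fun i => ∫ s in (0 : ℝ)..ξ, symbolCoeff e ħ c k₀ (A s) i

section Average

variable {e ħ c k₀ : ℝ} {A : ℝ → Plane}

theorem hasDerivAt_symbolPrimitive (hA : Continuous A) (ξ : ℝ) :
    HasDerivAt (symbolPrimitive e ħ c k₀ A) (symbolCoeff e ħ c k₀ (A ξ)) ξ := by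
  rw [hasDerivAt_pi]
  intro i
  have hc : Continuous fun s => symbolCoeff e ħ c k₀ (A s) i :=
    (continuous_apply i).comp ((continuous_symbolCoeff e ħ c k₀).comp hA)
  exact intervalIntegral.integral_hasDerivAt_right (hc.intervalIntegrable _ _)
    (hc.stronglyMeasurableAtFilter _ _) hc.continuousAt

theorem average_nonneg {f : ℝ → ℝ} (hf : ∀ s, 0 ≤ f s) (ξ : ℝ) : 0 ≤ average f ξ := by
  rw [average, smul_eq_mul]
  rcases le_total 0 ξ with h | h
  · exact mul_nonneg (inv_nonneg.2 h) (intervalIntegral.integral_nonneg h fun s _ => hf s)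
  · rw [intervalIntegral.integral_symm, mul_neg, ← neg_mul]
    exact mul_nonneg (neg_nonneg.2 (inv_nonpos.2 h))
      (intervalIntegral.integral_nonneg h fun s _ => hf s)

/-- At ξ = 0 the convention 0⁻¹ = 0 makes every average 0, including that of the constant α, hence ξ
≠ 0. -/
theorem average_quadratic (hA : Continuous A) {ξ : ℝ} (hξ : ξ ≠ 0) (α β γ : ℝ) (b : Plane) :
    average (fun s => α + β * inner ℝ (A s) b + γ * ‖A s‖ ^ 2) ξ =
      α + β * inner ℝ (average A ξ) b + γ * average (fun s => ‖A s‖ ^ 2) ξ := by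
  have hin : ∫ s in (0 : ℝ)..ξ, inner ℝ (A s) b = inner ℝ (∫ s in (0 : ℝ)..ξ, A s) b := by
    rw [real_inner_comm, ← innerSL_apply_apply ℝ,
      ← ContinuousLinearMap.intervalIntegral_comp_comm _ (hA.intervalIntegrable _ _)]
    refine intervalIntegral.integral_congr fun s _ => ?_
    simp only [innerSL_apply_apply]
    exact real_inner_comm _ _
  simp only [average, smul_eq_mul]
  rw [intervalIntegral.integral_add (Continuous.intervalIntegrable (by fun_prop) _ _)
      (Continuous.intervalIntegrable (by fun_prop) _ _),
    intervalIntegral.integral_add (Continuous.intervalIntegrable (by fun_prop) _ _)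
      (Continuous.intervalIntegrable (by fun_prop) _ _), intervalIntegral.integral_const_mul,
    intervalIntegral.integral_const_mul, hin, intervalIntegral.integral_const, real_inner_smul_left]
  simp only [sub_zero, smul_eq_mul]
  field_simp

/-- The difference is the average of |A - ⟨A⟩|². It makes the radicand of the effective mass
positive, so that squaring removes the root. -/
theorem average_variance_nonneg (hA : Continuous A) (ξ : ℝ) :
    0 ≤ average (fun s => ‖A s‖ ^ 2) ξ - ‖average A ξ‖ ^ 2 := by
  rcases eq_or_ne ξ 0 with rfl | hξ
  · simp [average]
  · have h := average_quadratic hA hξ (‖average A ξ‖ ^ 2) (-2) 1 (average A ξ)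
    have h0 : 0 ≤ average (fun s => ‖average A ξ‖ ^ 2 + -2 * inner ℝ (A s) (average A ξ) +
        1 * ‖A s‖ ^ 2) ξ := by
      refine average_nonneg (fun s => ?_) ξ
      have := norm_sub_sq_real (A s) (average A ξ)
      nlinarith [sq_nonneg ‖A s - average A ξ‖]
    rw [h, real_inner_self_eq_norm_sq] at h0
    linarith

theorem effectiveMass_sq (hħ : 0 < ħ) (hc : 0 < c) (hk₀ : 0 < k₀) (hA : Continuous A) (ξ : ℝ) :
    effectiveMass e ħ c k₀ A ξ ^ 2 = k₀ ^ 2 + (e / (ħ * c)) ^ 2 *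
      (average (fun s => ‖A s‖ ^ 2) ξ - ‖average A ξ‖ ^ 2) := by
  have h := average_variance_nonneg hA ξ
  rw [effectiveMass, mul_pow, Real.sq_sqrt (by positivity)]
  field_simp

/-- Completing the square in k: the mean of A shifts the momentum and its variance adds to the mass.
-/
theorem average_momentumParameter (hħ : 0 < ħ) (hc : 0 < c) (hk₀ : 0 < k₀) (hA : Continuous A)
    {ξ : ℝ} (hξ : ξ ≠ 0) (k : Plane) :
    average (momentumParameter e ħ c k₀ A k) ξ =
      ‖k + (e / (ħ * c)) • average A ξ‖ ^ 2 + effectiveMass e ħ c k₀ A ξ ^ 2 := by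
  have h := average_quadratic hA hξ (‖k‖ ^ 2 + k₀ ^ 2) (2 * e / (ħ * c))
    (e ^ 2 / (ħ ^ 2 * c ^ 2)) k
  have hfun : momentumParameter e ħ c k₀ A k = fun s => ‖k‖ ^ 2 + k₀ ^ 2 +
    2 * e / (ħ * c) * inner ℝ (A s) k + e ^ 2 / (ħ ^ 2 * c ^ 2) * ‖A s‖ ^ 2 := rfl
  rw [hfun, h, effectiveMass_sq hħ hc hk₀ hA, norm_add_sq_real, inner_smul_right, norm_smul,
    mul_pow, Real.norm_eq_abs, sq_abs, real_inner_comm]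
  field_simp
  ring

theorem sum_symbolPrimitive_mul_symbol (hA : Continuous A) (ξ : ℝ) (ζ : Plane) :
    ∑ i, symbolPrimitive e ħ c k₀ A ξ i * symbol i ζ =
      ξ * average (momentumParameter e ħ c k₀ A ((2 * Real.pi) • ζ)) ξ := by
  have hsum : ∑ i, symbolPrimitive e ħ c k₀ A ξ i * symbol i ζ =
      ∫ s in (0 : ℝ)..ξ, momentumParameter e ħ c k₀ A ((2 * Real.pi) • ζ) s := by
    simp_rw [← sum_symbolCoeff_mul_symbol, symbolPrimitive]
    rw [intervalIntegral.integral_finsetSum]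
    · exact Finset.sum_congr rfl fun i _ => (intervalIntegral.integral_mul_const _ _).symm
    · intro i _
      exact (((continuous_apply i).comp
        ((continuous_symbolCoeff e ħ c k₀).comp hA)).mul_const _).intervalIntegrable _ _
  rw [hsum, average, smul_eq_mul]
  rcases eq_or_ne ξ 0 with rfl | hξ
  · simp
  · field_simp

/-- The point of the parameter space at which the spectral integral gives the Volkov solution. At ξ
= 0 both sides are 0, so the value given to the averages there does not matter. -/
theorem sum_smul_symbolPrimitive (hħ : 0 < ħ) (hc : 0 < c) (hk₀ : 0 < k₀) (hA : Continuous A)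
    (ξ η : ℝ) (ζ : Plane) :
    ∑ i, (η • symbolPrimitive e ħ c k₀ A ξ) i * symbol i ζ = ξ * η *
      (‖(2 * Real.pi) • ζ + (e / (ħ * c)) • average A ξ‖ ^ 2 +
        effectiveMass e ħ c k₀ A ξ ^ 2) := by
  simp_rw [Pi.smul_apply, smul_eq_mul, mul_assoc η]
  rw [← Finset.mul_sum, sum_symbolPrimitive_mul_symbol hA]
  rcases eq_or_ne ξ 0 with rfl | hξ
  · simp
  · rw [average_momentumParameter hħ hc hk₀ hA hξ]
    ring

theorem smul_symbolPrimitive_mem (hħ : 0 < ħ) (hc : 0 < c) (hk₀ : 0 < k₀) (hA : Continuous A)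
    {ξ η : ℝ} (h : 0 ≤ ξ * η) : η • symbolPrimitive e ħ c k₀ A ξ ∈ symbolCone symbol := by
  intro ζ
  rw [sum_smul_symbolPrimitive hħ hc hk₀ hA]
  positivity

theorem smul_symbolPrimitive_mem_interior (hħ : 0 < ħ) (hc : 0 < c) (hk₀ : 0 < k₀)
    (hA : Continuous A) {ξ η : ℝ} (h : 0 < ξ * η) :
    η • symbolPrimitive e ħ c k₀ A ξ ∈ interior (symbolCone symbol) := by
  set b : Plane := (e / (ħ * c)) • average A ξ with hb
  -- From |k|² ≤ 2|k+b|² + 2|b|² one gets δ(1+|k|²) ≤ 2δ|k+b|² + δ(1+2|b|²). The two entries of the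
  -- minimum bound these terms by |k+b|² and k₀².
  set δ : ℝ := min (1 / 2) (k₀ ^ 2 / (1 + 2 * ‖b‖ ^ 2)) with hδ
  have hδ0 : 0 < δ := lt_min (by norm_num) (by positivity)
  have hδ1 : δ * (1 + 2 * ‖b‖ ^ 2) ≤ k₀ ^ 2 := by
    rw [← le_div_iff₀ (by positivity)]
    exact min_le_right _ _
  have hδ2 : δ ≤ 1 / 2 := min_le_left _ _
  refine mem_interior_symbolCone (mul_pos h hδ0) fun ζ => ?_
  rw [sum_smul_symbolPrimitive hħ hc hk₀ hA, mul_assoc]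
  refine mul_le_mul_of_nonneg_left ?_ h.le
  have hmass : k₀ ^ 2 ≤ effectiveMass e ħ c k₀ A ξ ^ 2 := by
    rw [effectiveMass_sq hħ hc hk₀ hA]
    have := mul_nonneg (sq_nonneg (e / (ħ * c))) (average_variance_nonneg hA ξ)
    linarith
  have htri : ‖(2 * Real.pi) • ζ‖ ^ 2 ≤ 2 * ‖(2 * Real.pi) • ζ + b‖ ^ 2 + 2 * ‖b‖ ^ 2 := by
    have h1 : ‖(2 * Real.pi) • ζ‖ ≤ ‖(2 * Real.pi) • ζ + b‖ + ‖b‖ := by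
      simpa using norm_sub_le ((2 * Real.pi) • ζ + b) b
    nlinarith [norm_nonneg ((2 * Real.pi) • ζ), sq_nonneg (‖(2 * Real.pi) • ζ + b‖ - ‖b‖)]
  have hζ : ‖ζ‖ ^ 2 ≤ ‖(2 * Real.pi) • ζ‖ ^ 2 := by
    rw [norm_smul, mul_pow, Real.norm_eq_abs, sq_abs]
    have : 1 ≤ (2 * Real.pi) ^ 2 := by nlinarith [Real.pi_gt_three]
    nlinarith [sq_nonneg ‖ζ‖]
  nlinarith [sq_nonneg ‖(2 * Real.pi) • ζ + b‖]

/-- The spectral representation of the Volkov solution. -/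
theorem volkovSolution_eq_spectralIntegral (hħ : 0 < ħ) (hc : 0 < c) (hk₀ : 0 < k₀)
    (hA : Continuous A) {ξ η : ℝ} (h : 0 ≤ ξ * η) (φ : 𝓢(Plane, ℂ)) :
    volkovSolution e ħ c k₀ A ξ η φ =
      spectralIntegral symbol 0 (𝓕⁻ φ) (η • symbolPrimitive e ħ c k₀ A ξ) := by
  set φ₁ : 𝓢(Plane, ℂ) := SchwartzMap.smulLeftCLM ℂ (phase e ħ c A ξ) φ with hφ₁
  have h1 : volkovSolution e ħ c k₀ A ξ η φ =
      freeSolution (effectiveMass e ħ c k₀ A ξ) (ξ * η) (𝓕 (𝓕⁻ φ₁)) := by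
    rw [FourierTransform.fourier_fourierInv_eq]
    rfl
  set b : Plane := (2 * Real.pi)⁻¹ • ((e / (ħ * c)) • average A ξ) with hb
  rw [h1, freeSolution_fourier _ h, spectralIntegral]
  -- Translation by b undoes the shift that the phase causes in the inverse Fourier transform.
  refine Eq.trans ?_ (integral_sub_right_eq_self (fun ζ => (besselEntire 0 (∑ i,
    (η • symbolPrimitive e ħ c k₀ A ξ) i * symbol i ζ) : ℂ) * 𝓕⁻ φ ζ) b)
  refine integral_congr_ae (Eventually.of_forall fun ζ => ?_)
  simp only
  rw [hφ₁, fourierInv_phase_mul, ← hb, sum_smul_symbolPrimitive hħ hc hk₀ hA]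
  congr 4
  have hpi : (2 * Real.pi) ≠ 0 := by positivity
  rw [smul_sub, hb, smul_inv_smul₀ hpi, sub_add_cancel, norm_smul, Real.norm_eq_abs, mul_pow |_|, sq_abs]

/-- The spectral representation in terms of the momentum `k = 2πζ`. -/
theorem volkovSolution_eq_integral (hħ : 0 < ħ) (hc : 0 < c) (hk₀ : 0 < k₀)
    (hA : Continuous A) {ξ η : ℝ} (h : 0 ≤ ξ * η) (φ : 𝓢(Plane, ℂ)) :
    volkovSolution e ħ c k₀ A ξ η φ =
      1 / (4 * (Real.pi : ℂ) ^ 2) * ∫ k : Plane,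
        (besselJ 0 √(ξ * η * average (momentumParameter e ħ c k₀ A k) ξ) : ℂ) *
        ∫ x : Plane, Complex.exp (Complex.I * (inner ℝ k x : ℝ)) * φ x := by
  -- The substitution k = 2πζ in the plane is the origin of the factor 1/(4π²).
  have hscale := Measure.integral_comp_smul (volume : Measure Plane) (fun k : Plane =>
    (besselJ 0 √(ξ * η * average (momentumParameter e ħ c k₀ A k) ξ) : ℂ) *
        ∫ x : Plane, Complex.exp (Complex.I * (inner ℝ k x : ℝ)) * φ x) (2 * Real.pi)
  rw [finrank_euclideanSpace_fin, abs_of_pos (by positivity), Complex.real_smul] at hscale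
  have hcoef : (((((2 * Real.pi) ^ 2)⁻¹ : ℝ)) : ℂ) = 1 / (4 * (Real.pi : ℂ) ^ 2) := by
    push_cast
    rw [mul_pow, one_div]
    norm_num
  rw [← hcoef, ← hscale, volkovSolution_eq_spectralIntegral hħ hc hk₀ hA h, spectralIntegral]
  refine integral_congr_ae (Eventually.of_forall fun ζ => ?_)
  simp only
  have hsum : ∑ i, (η • symbolPrimitive e ħ c k₀ A ξ) i * symbol i ζ =
      ξ * η * average (momentumParameter e ħ c k₀ A ((2 * Real.pi) • ζ)) ξ := by
    simp_rw [Pi.smul_apply, smul_eq_mul, mul_assoc η]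
    rw [← Finset.mul_sum, sum_symbolPrimitive_mul_symbol hA]
    ring
  have hpos := smul_symbolPrimitive_mem (e := e) hħ hc hk₀ hA h ζ
  rw [hsum] at hpos
  rw [hsum, besselJ_zero_sqrt hpos, SchwartzMap.fourierInv_coe, Real.fourierInv_eq']
  congr 1
  refine integral_congr_ae (Eventually.of_forall fun x => ?_)
  simp only [smul_eq_mul]
  rw [real_inner_smul_left, real_inner_comm, mul_comm Complex.I]

end Average

/-! ### The equation on the Fourier side; existence and regularity of the solution. -/

theorem laplacian_fourier (ρ : 𝓢(Plane, ℂ)) :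
    Δ (𝓕 ρ) = 𝓕 (-(mulSymbol (symbol 0) ρ)) := by
  have hb : ∀ i : Fin 2, ∂_{EuclideanSpace.basisFun (Fin 2) ℝ i}
      (∂_{EuclideanSpace.basisFun (Fin 2) ℝ i} (𝓕 ρ)) =
      𝓕 (-(2 * Real.pi * Complex.I) • mulSymbol
        (inner ℝ · (EuclideanSpace.basisFun (Fin 2) ℝ i)) (-(2 * Real.pi * Complex.I) •
          mulSymbol (inner ℝ · (EuclideanSpace.basisFun (Fin 2) ℝ i)) ρ)) := fun i => by
    rw [SchwartzMap.lineDerivOp_fourier_eq, SchwartzMap.lineDerivOp_fourier_eq]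
  rw [SchwartzMap.laplacian_eq_sum (EuclideanSpace.basisFun (Fin 2) ℝ), Fin.sum_univ_two, hb, hb,
    ← FourierTransform.fourier_add]
  congr 1
  ext ζ
  have ht : ∀ v : Plane, Function.HasTemperateGrowth fun ζ : Plane => (inner ℝ ζ v : ℝ) :=
    fun v => by fun_prop
  have hn : ‖ζ‖ ^ 2 = ζ 0 ^ 2 + ζ 1 ^ 2 := by
    rw [EuclideanSpace.real_norm_sq_eq, Fin.sum_univ_two]
  have hs : symbol 0 ζ = (2 * Real.pi) ^ 2 * (ζ 0 ^ 2 + ζ 1 ^ 2) := by rw [← hn]; rfl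
  simp only [add_apply, neg_apply, smul_apply,
    mulSymbol_apply (ht _), mulSymbol_apply (hasTemperateGrowth_symbol 0), hs]
  simp [EuclideanSpace.basisFun_apply, EuclideanSpace.inner_single_right]
  ring_nf
  simp only [Complex.I_sq]
  ring

/-- The transverse operator acts on the Fourier side as multiplication by `-K²`. -/
theorem transverseOperator_fourier (e ħ c k₀ : ℝ) (a : Plane) (T : 𝓢'(Plane, ℂ))
    (ρ : 𝓢(Plane, ℂ)) :
    transverseOperator e ħ c k₀ a T (𝓕 ρ) =
      -∑ i, (symbolCoeff e ħ c k₀ a i : ℂ) * T (𝓕 (mulSymbol (symbol i) ρ)) := by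
  have h : transverseOperator e ħ c k₀ a T (𝓕 ρ) = T (Δ (𝓕 ρ)) - ((k₀ ^ 2 : ℝ) : ℂ) * T (𝓕 ρ) +
      (2 * Complex.I * e / (ħ * c) : ℂ) * T (-∂_{a} (𝓕 ρ)) -
      ((e ^ 2 / (ħ ^ 2 * c ^ 2) * ‖a‖ ^ 2 : ℝ) : ℂ) * T (𝓕 ρ) := by
    rw [← TemperedDistribution.laplacian_apply_apply, ← TemperedDistribution.lineDerivOp_apply_apply]
    rfl
  have ht : Function.HasTemperateGrowth fun ζ : Plane => (inner ℝ ζ a : ℝ) := by fun_prop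
  have hline : -∂_{a} (𝓕 ρ) = 𝓕 (Complex.I • (((a 0 : ℝ) : ℂ) • mulSymbol (symbol 1) ρ +
      ((a 1 : ℝ) : ℂ) • mulSymbol (symbol 2) ρ)) := by
    rw [SchwartzMap.lineDerivOp_fourier_eq, ← neg_one_smul ℂ, ← FourierTransform.fourier_smul]
    congr 1
    ext ζ
    have h1 : symbol 1 ζ = 2 * Real.pi * ζ 0 := rfl
    have h2 : symbol 2 ζ = 2 * Real.pi * ζ 1 := rfl
    have h3 : (inner ℝ ζ a : ℝ) = a 0 * ζ 0 + a 1 * ζ 1 := by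
      simp [PiLp.inner_apply, Fin.sum_univ_two]
    simp only [add_apply, smul_apply,
      mulSymbol_apply ht, mulSymbol_apply (hasTemperateGrowth_symbol _), h1, h2, h3, smul_eq_mul]
    push_cast
    ring
  have hone : mulSymbol (symbol 3) ρ = ρ := by
    ext ζ
    rw [mulSymbol_apply (hasTemperateGrowth_symbol 3)]
    simp [symbol]
  have hneg : 𝓕 (-(mulSymbol (symbol 0) ρ)) = -𝓕 (mulSymbol (symbol 0) ρ) := by
    rw [← neg_one_smul ℂ, FourierTransform.fourier_smul, neg_one_smul]
  rw [h, laplacian_fourier, hline, FourierTransform.fourier_smul, FourierTransform.fourier_add,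
    FourierTransform.fourier_smul, FourierTransform.fourier_smul, Fin.sum_univ_four, hone, hneg]
  simp only [map_neg, map_smul, map_add, smul_eq_mul, symbolCoeff, Matrix.cons_val_zero,
    Matrix.cons_val_one, Matrix.cons_val]
  push_cast
  ring_nf
  simp only [Complex.I_sq]
  ring

theorem hasDerivAt_spectralIntegral_comp {ι : Type} [Fintype ι] {m : ι → Plane → ℝ}
    (hm : ∀ i, (m i).HasTemperateGrowth) (n : ℕ) (ρ : 𝓢(Plane, ℂ)) {v : ℝ → ι → ℝ} {v' : ι → ℝ}
    {t : ℝ} (hv : HasDerivAt v v' t) (hmem : v t ∈ interior (symbolCone m)) :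
    HasDerivAt (fun t => spectralIntegral m n ρ (v t))
      (∑ i, (v' i : ℂ) * spectralIntegral m (n + 1) (mulSymbol (m i) ρ) (v t)) t := by
  have h := (hasFDerivAt_spectralIntegral hm n ρ hmem).comp_hasDerivAt t hv
  refine h.congr_deriv ?_
  simp

theorem mulSymbol_comm {g h : Plane → ℝ} (hg : g.HasTemperateGrowth) (hh : h.HasTemperateGrowth)
    (ρ : 𝓢(Plane, ℂ)) : mulSymbol g (mulSymbol h ρ) = mulSymbol h (mulSymbol g ρ) := by
  ext ζ
  rw [mulSymbol_apply hg, mulSymbol_apply hh, mulSymbol_apply hh, mulSymbol_apply hg]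
  ring

section FundamentalSolution

variable {e ħ c k₀ : ℝ} {A : ℝ → Plane}

theorem continuous_symbolPrimitive (hA : Continuous A) :
    Continuous (symbolPrimitive e ħ c k₀ A) :=
  continuous_iff_continuousAt.2 fun ξ => (hasDerivAt_symbolPrimitive hA ξ).continuousAt

theorem hasDerivAt_volkovSolution_right (hħ : 0 < ħ) (hc : 0 < c) (hk₀ : 0 < k₀)
    (hA : Continuous A) (φ : 𝓢(Plane, ℂ)) {ξ η : ℝ} (h : 0 < ξ * η) :
    HasDerivAt (fun y => volkovSolution e ħ c k₀ A ξ y φ)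
      (∑ i, (symbolPrimitive e ħ c k₀ A ξ i : ℂ) * spectralIntegral symbol 1
        (mulSymbol (symbol i) (𝓕⁻ φ)) (η • symbolPrimitive e ħ c k₀ A ξ)) η := by
  have hv : HasDerivAt (fun y : ℝ => y • symbolPrimitive e ħ c k₀ A ξ)
      (symbolPrimitive e ħ c k₀ A ξ) η := by
    simpa using (hasDerivAt_id η).smul_const (symbolPrimitive e ħ c k₀ A ξ)
  refine (hasDerivAt_spectralIntegral_comp hasTemperateGrowth_symbol 0 (𝓕⁻ φ) hv
    (smul_symbolPrimitive_mem_interior hħ hc hk₀ hA h)).congr_of_eventuallyEq ?_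
  have ho : ∀ᶠ y in 𝓝 η, 0 < ξ * y :=
    (continuous_const.mul continuous_id).continuousAt.eventually (lt_mem_nhds h)
  filter_upwards [ho] with y hy
  exact volkovSolution_eq_spectralIntegral hħ hc hk₀ hA hy.le φ

/-- Everything is read off the spectral integral at η g(ξ), with g the primitive of the
coefficients. Only one ξ-derivative of g occurs, so continuity of A suffices. -/
theorem isFundamentalSolution_volkovSolution (hħ : 0 < ħ) (hc : 0 < c) (hk₀ : 0 < k₀)
    (hA : Continuous A) : IsFundamentalSolution e ħ c k₀ A (volkovSolution e ħ c k₀ A) where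
  continuousOn φ := by
    refine ContinuousOn.congr (f := fun p : ℝ × ℝ => spectralIntegral symbol 0 (𝓕⁻ φ)
      (p.2 • symbolPrimitive e ħ c k₀ A p.1)) ?_
      fun p hp => volkovSolution_eq_spectralIntegral hħ hc hk₀ hA hp φ
    refine (continuousOn_spectralIntegral hasTemperateGrowth_symbol 0 (𝓕⁻ φ)).comp
      (Continuous.continuousOn ?_) fun p hp => smul_symbolPrimitive_mem hħ hc hk₀ hA hp
    have := continuous_symbolPrimitive (e := e) (ħ := ħ) (c := c) (k₀ := k₀) hA
    fun_prop
  boundary ξ η h := by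
    ext φ
    rw [volkovSolution_eq_spectralIntegral hħ hc hk₀ hA h.ge, TemperedDistribution.delta_apply,
      spectralIntegral]
    -- On the axes the argument of J₀ is 0 and J₀(0) = 1, so the integral of `𝓕⁻ φ` remains, which
    -- is φ(0).
    simp_rw [sum_smul_symbolPrimitive hħ hc hk₀ hA, h, zero_mul, besselEntire_zero_right]
    have h1 := fourier_eq_integral_planeWave (𝓕⁻ φ) 0
    rw [FourierTransform.fourier_fourierInv_eq] at h1
    rw [h1]
    refine integral_congr_ae (Eventually.of_forall fun ζ => ?_)
    simp [planeWave]
  differentiable φ ξ η h :=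
    (hasDerivAt_volkovSolution_right hħ hc hk₀ hA φ h).differentiableAt
  equation φ ξ η h := by
    set ρ := 𝓕⁻ φ with hρ
    set g := symbolPrimitive e ħ c k₀ A with hg
    set a := symbolCoeff e ħ c k₀ (A ξ) with ha
    have hmem := smul_symbolPrimitive_mem_interior (e := e) hħ hc hk₀ hA h
    have hgd : HasDerivAt g a ξ := hasDerivAt_symbolPrimitive hA ξ
    have hd : HasDerivAt (fun x => ∑ i, (g x i : ℂ) * spectralIntegral symbol 1
        (mulSymbol (symbol i) ρ) (η • g x))
        (∑ i, ((a i : ℂ) * spectralIntegral symbol 1 (mulSymbol (symbol i) ρ) (η • g ξ) +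
          (g ξ i : ℂ) * ∑ l, ((η • a) l : ℂ) * spectralIntegral symbol 2
            (mulSymbol (symbol l) (mulSymbol (symbol i) ρ)) (η • g ξ))) ξ := by
      refine HasDerivAt.fun_sum fun i _ => ?_
      exact ((hasDerivAt_pi.1 hgd i).ofReal_comp).mul
        (hasDerivAt_spectralIntegral_comp hasTemperateGrowth_symbol 1 _ (hgd.const_smul η) hmem)
    refine ⟨_, hd.congr_of_eventuallyEq ?_, ?_⟩
    · have ho : ∀ᶠ x in 𝓝 ξ, 0 < x * η :=
        (continuous_id.mul continuous_const).continuousAt.eventually (lt_mem_nhds h)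
      filter_upwards [ho] with x hx
      exact (hasDerivAt_volkovSolution_right hħ hc hk₀ hA φ hx).deriv
    · have hφ : φ = 𝓕 ρ := (FourierTransform.fourier_fourierInv_eq φ).symm
      conv_lhs => rw [hφ]
      rw [transverseOperator_fourier]
      have hs : ∀ σ : 𝓢(Plane, ℂ), volkovSolution e ħ c k₀ A ξ η (𝓕 σ) =
          spectralIntegral symbol 0 σ (η • g ξ) := fun σ => by
        rw [volkovSolution_eq_spectralIntegral hħ hc hk₀ hA h.le,
          FourierTransform.fourierInv_fourier_eq]
      simp_rw [hs]
      have hrec := fun l => spectralIntegral_recurrence hasTemperateGrowth_symbol 0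
        (mulSymbol (symbol l) ρ) (interior_subset hmem)
      have hcomm := fun i l => mulSymbol_comm (hasTemperateGrowth_symbol i)
        (hasTemperateGrowth_symbol l) ρ
      -- Exchanging the two sums collects the second-order terms under a common factor a_l. For each
      -- l what remains is the integrated Bessel equation with density m_l ρ.
      have h1 : ∑ i, (g ξ i : ℂ) * ∑ l, ((η • a) l : ℂ) * spectralIntegral symbol 2
            (mulSymbol (symbol l) (mulSymbol (symbol i) ρ)) (η • g ξ) =
          ∑ l, (a l : ℂ) * ∑ i, ((η • g ξ) i : ℂ) * spectralIntegral symbol 2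
            (mulSymbol (symbol i) (mulSymbol (symbol l) ρ)) (η • g ξ) := by
        simp_rw [Finset.mul_sum]
        rw [Finset.sum_comm]
        refine Finset.sum_congr rfl fun l _ => Finset.sum_congr rfl fun i _ => ?_
        rw [hcomm l i]
        simp only [Pi.smul_apply, smul_eq_mul]
        push_cast
        ring
      rw [Finset.sum_add_distrib, h1, ← Finset.sum_add_distrib, Finset.mul_sum, ← sub_eq_add_neg,
        ← Finset.sum_sub_distrib]
      refine Finset.sum_eq_zero fun l _ => ?_
      have hl := hrec l
      simp only [zero_add, Nat.cast_zero, one_mul] at hl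
      linear_combination (-4 * (a l : ℂ)) * hl

/-- Integration in ξ gains one derivative over A. -/
theorem contDiff_symbolPrimitive (hA : ContDiff ℝ 1 A) :
    ContDiff ℝ 2 (symbolPrimitive e ħ c k₀ A) := by
  have hd := fun ξ => hasDerivAt_symbolPrimitive (e := e) (ħ := ħ) (c := c) (k₀ := k₀)
    hA.continuous ξ
  rw [show (2 : WithTop ℕ∞) = 1 + 1 by norm_num, contDiff_succ_iff_deriv]
  refine ⟨fun ξ => (hd ξ).differentiableAt, fun h => by simp at h, ?_⟩
  rw [show deriv (symbolPrimitive e ħ c k₀ A) = fun ξ => symbolCoeff e ħ c k₀ (A ξ) from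
    funext fun ξ => (hd ξ).deriv]
  have hcoord : ∀ j : Fin 2, ContDiff ℝ 1 fun ξ => A ξ j :=
    contDiff_euclidean.1 hA
  refine contDiff_pi.2 fun i => ?_
  fin_cases i
  · exact contDiff_const
  · exact contDiff_const.mul (hcoord 0)
  · exact contDiff_const.mul (hcoord 1)
  · exact contDiff_const.add (contDiff_const.mul (hA.norm_sq ℝ))

theorem isOpen_mul_pos : IsOpen {p : ℝ × ℝ | 0 < p.1 * p.2} :=
  isOpen_lt continuous_const (by fun_prop)

theorem contDiffOn_volkovSolution (hħ : 0 < ħ) (hc : 0 < c) (hk₀ : 0 < k₀)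
    (hA : ContDiff ℝ 1 A) (φ : 𝓢(Plane, ℂ)) :
    ContDiffOn ℝ 2 (fun p : ℝ × ℝ => volkovSolution e ħ c k₀ A p.1 p.2 φ)
      {p | 0 < p.1 * p.2} := by
  refine ContDiffOn.congr (f := fun p : ℝ × ℝ => spectralIntegral symbol 0 (𝓕⁻ φ)
      (p.2 • symbolPrimitive e ħ c k₀ A p.1)) ?_
      fun p hp => volkovSolution_eq_spectralIntegral hħ hc hk₀ hA.continuous (le_of_lt hp) φ
  have hv : ContDiff ℝ 2 fun p : ℝ × ℝ => p.2 • symbolPrimitive e ħ c k₀ A p.1 :=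
    contDiff_snd.smul ((contDiff_symbolPrimitive hA).comp contDiff_fst)
  have hs : ContDiffOn ℝ 2 (spectralIntegral symbol 0 (𝓕⁻ φ)) (interior (symbolCone symbol)) := by
    exact_mod_cast contDiffOn_spectralIntegral hasTemperateGrowth_symbol 2 0 (𝓕⁻ φ)
  exact hs.comp hv.contDiffOn
    fun p hp => smul_symbolPrimitive_mem_interior hħ hc hk₀ hA.continuous hp

end FundamentalSolution

/-! ### From the mixed derivative in ξ, η to the wave operator in z, t. -/

section SecondDerivatives

variable {f : ℝ × ℝ → ℂ} {p v : ℝ × ℝ}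

theorem hasFDerivAt_fderiv_of_contDiffAt (hf : ContDiffAt ℝ 2 f p) :
    HasFDerivAt (fderiv ℝ f) (fderiv ℝ (fderiv ℝ f) p) p :=
  ((hf.fderiv_right (m := 1) (by norm_num)).differentiableAt one_ne_zero).hasFDerivAt

theorem iteratedDeriv_two_comp_line {l : ℝ → ℝ × ℝ} (hl : ∀ t, HasDerivAt l v t) {t : ℝ}
    (hf : ContDiffAt ℝ 2 f (l t)) :
    iteratedDeriv 2 (fun t => f (l t)) t = fderiv ℝ (fderiv ℝ f) (l t) v v := by
  have hev : ∀ᶠ s in 𝓝 t, ContDiffAt ℝ 2 f (l s) :=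
    (hl t).continuousAt.eventually (hf.eventually (by simp))
  have h1 : deriv (fun t => f (l t)) =ᶠ[𝓝 t] fun s => fderiv ℝ f (l s) v := by
    filter_upwards [hev] with s hs
    exact ((hs.differentiableAt two_ne_zero).hasFDerivAt.comp_hasDerivAt s (hl s)).deriv
  rw [iteratedDeriv_succ, iteratedDeriv_one, h1.deriv_eq]
  have h2 := (hasFDerivAt_fderiv_of_contDiffAt hf).comp_hasDerivAt t (hl t)
  exact (h2.clm_apply (hasDerivAt_const t v)).deriv.trans (by simp)

theorem hasDerivAt_deriv_of_contDiffAt {ξ η : ℝ} (hf : ContDiffAt ℝ 2 f (ξ, η)) :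
    HasDerivAt (fun x => deriv (fun y => f (x, y)) η)
      (fderiv ℝ (fderiv ℝ f) (ξ, η) (1, 0) (0, 1)) ξ := by
  have hl : ∀ x, HasDerivAt (fun x : ℝ => (x, η)) ((1 : ℝ), (0 : ℝ)) x := fun x =>
    (hasDerivAt_id x).prodMk (hasDerivAt_const x η)
  have hr : ∀ x y, HasDerivAt (fun y : ℝ => (x, y)) ((0 : ℝ), (1 : ℝ)) y := fun x y =>
    (hasDerivAt_const y x).prodMk (hasDerivAt_id y)
  have hev : ∀ᶠ x in 𝓝 ξ, ContDiffAt ℝ 2 f (x, η) :=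
    (hl ξ).continuousAt.eventually (hf.eventually (by simp))
  have h1 : (fun x => deriv (fun y => f (x, y)) η) =ᶠ[𝓝 ξ] fun x => fderiv ℝ f (x, η) (0, 1) := by
    filter_upwards [hev] with x hx
    exact ((hx.differentiableAt two_ne_zero).hasFDerivAt.comp_hasDerivAt η (hr x η)).deriv
  have h2 := (hasFDerivAt_fderiv_of_contDiffAt hf).comp_hasDerivAt ξ (hl ξ)
  have h3 := h2.clm_apply (hasDerivAt_const ξ ((0 : ℝ), (1 : ℝ)))
  exact (h3.congr_deriv (by simp)).congr_of_eventuallyEq h1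

/-- In the variables `ξ = ct - z`, `η = ct + z`, the wave operator is `-4 ∂²/∂ξ∂η`. -/
theorem wave_eq_mixed_derivative {c : ℝ} (hc : c ≠ 0) {z t : ℝ}
    (hf : ContDiffAt ℝ 2 f (c * t - z, c * t + z)) :
    iteratedDeriv 2 (fun z => f (c * t - z, c * t + z)) z -
      1 / (c : ℂ) ^ 2 * iteratedDeriv 2 (fun t => f (c * t - z, c * t + z)) t =
      -4 * fderiv ℝ (fderiv ℝ f) (c * t - z, c * t + z) (1, 0) (0, 1) := by
  have hz : ∀ z, HasDerivAt (fun z : ℝ => (c * t - z, c * t + z)) ((-1 : ℝ), (1 : ℝ)) z := fun z =>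
    ((hasDerivAt_id z).const_sub (c * t)).prodMk ((hasDerivAt_id z).const_add (c * t))
  have ht : ∀ t, HasDerivAt (fun t : ℝ => (c * t - z, c * t + z)) (c, c) t := fun t => by
    have h := (hasDerivAt_id t).const_mul c
    simpa using (h.sub_const z).prodMk (h.add_const z)
  rw [iteratedDeriv_two_comp_line hz hf, iteratedDeriv_two_comp_line ht hf]
  -- Symmetry of the second derivative B makes the cross terms equal; expanding along (-1, 1) and
  -- (c, c) then cancels the pure second derivatives.
  have hsymm : IsSymmSndFDerivAt ℝ f (c * t - z, c * t + z) :=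
    hf.isSymmSndFDerivAt (by simp)
  set B := fderiv ℝ (fderiv ℝ f) (c * t - z, c * t + z) with hB
  have h1 : ((-1 : ℝ), (1 : ℝ)) = (-1 : ℝ) • ((1 : ℝ), (0 : ℝ)) + (1 : ℝ) • ((0 : ℝ), (1 : ℝ)) := by
    simp
  have h2 : (c, c) = c • ((1 : ℝ), (0 : ℝ)) + c • ((0 : ℝ), (1 : ℝ)) := by simp
  have h3 : B (0, 1) (1, 0) = B (1, 0) (0, 1) := hsymm (0, 1) (1, 0)
  rw [h1, h2]
  simp only [map_add, map_smul, _root_.add_apply, _root_.smul_apply, Complex.real_smul, h3]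
  have hc' : (c : ℂ) ≠ 0 := by exact_mod_cast hc
  push_cast
  field_simp
  ring

end SecondDerivatives

theorem volkovSolution_wave_equation {e ħ c k₀ : ℝ} {A : ℝ → Plane} (hħ : 0 < ħ) (hc : 0 < c)
    (hk₀ : 0 < k₀) (hA : ContDiff ℝ 1 A) (φ : 𝓢(Plane, ℂ)) :
    ContDiffOn ℝ 2
        (fun p : ℝ × ℝ => volkovSolution e ħ c k₀ A (c * p.2 - p.1) (c * p.2 + p.1) φ)
        {p | 0 < c ^ 2 * p.2 ^ 2 - p.1 ^ 2} ∧
      ∀ z t : ℝ, 0 < c ^ 2 * t ^ 2 - z ^ 2 →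
        iteratedDeriv 2
          (fun z' => volkovSolution e ħ c k₀ A (c * t - z') (c * t + z') φ) z
        - 1 / (c : ℂ) ^ 2 * iteratedDeriv 2
          (fun t' => volkovSolution e ħ c k₀ A (c * t' - z) (c * t' + z) φ) t
        + transverseOperator e ħ c k₀ (A (c * t - z))
            (volkovSolution e ħ c k₀ A (c * t - z) (c * t + z)) φ = 0 := by
  have hC := contDiffOn_volkovSolution (e := e) hħ hc hk₀ hA φ
  constructor
  · refine ContDiffOn.comp (g := fun p : ℝ × ℝ => volkovSolution e ħ c k₀ A p.1 p.2 φ)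
      (f := fun p : ℝ × ℝ => (c * p.2 - p.1, c * p.2 + p.1)) hC
      (ContDiff.contDiffOn (by fun_prop)) fun p hp => ?_
    change 0 < (c * p.2 - p.1) * (c * p.2 + p.1)
    have hp' : 0 < c ^ 2 * p.2 ^ 2 - p.1 ^ 2 := hp
    linarith
  · intro z t h
    have h' : 0 < (c * t - z) * (c * t + z) := by linarith
    have hat : ContDiffAt ℝ 2 (fun p : ℝ × ℝ => volkovSolution e ħ c k₀ A p.1 p.2 φ)
        (c * t - z, c * t + z) := hC.contDiffAt (isOpen_mul_pos.mem_nhds h')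
    obtain ⟨w, hw, heq⟩ := (isFundamentalSolution_volkovSolution (e := e) hħ hc hk₀
      hA.continuous).equation φ _ _ h'
    -- The mixed derivative already obtained for continuous A coincides with the one computed from
    -- the second Fréchet derivative.
    have hw' := hw.unique (hasDerivAt_deriv_of_contDiffAt hat)
    rw [wave_eq_mixed_derivative hc.ne' hat, ← hw']
    exact heq

/-! ### Uniform boundedness on bounded families of Schwartz functions. -/

section UniformBoundedness

variable {α : Type*}

theorem seminorm_le_tsum {φ : α → 𝓢(Plane, ℂ)}
    (h : ∀ k n, Summable fun a => SchwartzMap.seminorm ℂ k n (φ a)) {Φ : 𝓢(Plane, ℂ)}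
    (hΦ : ∀ x, Φ x = ∑' a, φ a x) (k n : ℕ) :
    SchwartzMap.seminorm ℂ k n Φ ≤ ∑' a, SchwartzMap.seminorm ℂ k n (φ a) := by
  refine SchwartzMap.seminorm_le_bound ℂ k n Φ (tsum_nonneg fun a => apply_nonneg _ _) fun x => ?_
  have hd := iteratedFDeriv_tsum (𝕜 := ℝ) (N := ⊤) (f := fun a => (φ a : Plane → ℂ))
    (v := fun k a => SchwartzMap.seminorm ℂ 0 k (φ a)) (fun a => (φ a).smooth ⊤)
    (fun k _ => h 0 k) (fun k a x _ => SchwartzMap.norm_iteratedFDeriv_le_seminorm ℂ (φ a) k x)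
    (k := n) le_top
  rw [show (Φ : Plane → ℂ) = fun x => ∑' a, φ a x from funext hΦ, hd]
  have hs : Summable fun a => ‖iteratedFDeriv ℝ n (φ a) x‖ :=
    Summable.of_nonneg_of_le (fun _ => norm_nonneg _)
      (fun a => SchwartzMap.norm_iteratedFDeriv_le_seminorm ℂ (φ a) n x) (h 0 n)
  calc ‖x‖ ^ k * ‖∑' a, iteratedFDeriv ℝ n (φ a) x‖
      ≤ ‖x‖ ^ k * ∑' a, ‖iteratedFDeriv ℝ n (φ a) x‖ := by
        gcongr
        exact norm_tsum_le_tsum_norm hs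
    _ = ∑' a, ‖x‖ ^ k * ‖iteratedFDeriv ℝ n (φ a) x‖ := tsum_mul_left.symm
    _ ≤ _ := (hs.mul_left _).tsum_le_tsum (fun a => SchwartzMap.le_seminorm ℂ k n (φ a) x) (h k n)

theorem exists_schwartzMap_eq_tsum {φ : α → 𝓢(Plane, ℂ)}
    (h : ∀ k n, Summable fun a => SchwartzMap.seminorm ℂ k n (φ a)) :
    ∃ Φ : 𝓢(Plane, ℂ), ∀ x, Φ x = ∑' a, φ a x := by
  have hd := fun n : ℕ => iteratedFDeriv_tsum (𝕜 := ℝ) (N := ⊤) (f := fun a => (φ a : Plane → ℂ))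
    (v := fun k a => SchwartzMap.seminorm ℂ 0 k (φ a)) (fun a => (φ a).smooth ⊤)
    (fun k _ => h 0 k) (fun k a x _ => SchwartzMap.norm_iteratedFDeriv_le_seminorm ℂ (φ a) k x)
    (k := n) le_top
  refine ⟨⟨fun x => ∑' a, φ a x, ?_, fun k n => ⟨∑' a, SchwartzMap.seminorm ℂ k n (φ a),
    fun x => ?_⟩⟩, fun x => rfl⟩
  · exact contDiff_tsum (𝕜 := ℝ) (N := ⊤) (v := fun k a => SchwartzMap.seminorm ℂ 0 k (φ a))
      (fun a => (φ a).smooth ⊤) (fun k _ => h 0 k)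
      (fun k a x _ => SchwartzMap.norm_iteratedFDeriv_le_seminorm ℂ (φ a) k x)
  · have hs : Summable fun a => ‖iteratedFDeriv ℝ n (φ a) x‖ :=
      Summable.of_nonneg_of_le (fun _ => norm_nonneg _)
        (fun a => SchwartzMap.norm_iteratedFDeriv_le_seminorm ℂ (φ a) n x) (h 0 n)
    rw [hd]
    calc ‖x‖ ^ k * ‖∑' a, iteratedFDeriv ℝ n (φ a) x‖
        ≤ ‖x‖ ^ k * ∑' a, ‖iteratedFDeriv ℝ n (φ a) x‖ := by
          gcongr
          exact norm_tsum_le_tsum_norm hs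
      _ = ∑' a, ‖x‖ ^ k * ‖iteratedFDeriv ℝ n (φ a) x‖ := tsum_mul_left.symm
      _ ≤ _ := (hs.mul_left _).tsum_le_tsum (fun a => SchwartzMap.le_seminorm ℂ k n (φ a) x) (h k n)

/-- A family of Schwartz functions with summable seminorms is summable. -/
theorem exists_hasSum_schwartzMap {φ : α → 𝓢(Plane, ℂ)}
    (h : ∀ k n, Summable fun a => SchwartzMap.seminorm ℂ k n (φ a)) :
    ∃ Φ : 𝓢(Plane, ℂ), HasSum φ Φ ∧
      ∀ k n, SchwartzMap.seminorm ℂ k n Φ ≤ ∑' a, SchwartzMap.seminorm ℂ k n (φ a) := by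
  obtain ⟨Φ, hΦ⟩ := exists_schwartzMap_eq_tsum h
  refine ⟨Φ, ?_, seminorm_le_tsum h hΦ⟩
  rw [HasSum, SummationFilter.unconditional_filter,
    (schwartz_withSeminorms ℂ Plane ℂ).tendsto_nhds]
  rintro ⟨k, n⟩ ε hε
  have htail := (tendsto_tsum_compl_atTop_zero
    fun a => SchwartzMap.seminorm ℂ k n (φ a)).eventually (gt_mem_nhds hε)
  filter_upwards [htail] with s hs
  refine lt_of_le_of_lt ?_ hs
  rw [SchwartzMap.schwartzSeminormFamily_apply, ← map_neg_eq_map, neg_sub]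
  -- The error of a partial sum is itself the sum of the family over the complement, so its seminorm
  -- is at most the tail.
  refine seminorm_le_tsum (φ := fun a : {a // a ∉ s} => φ a)
    (fun k n => (h k n).subtype _) (fun x => ?_) k n
  have hx : Summable fun a => φ a x := Summable.of_norm_bounded (h 0 0) fun a =>
    SchwartzMap.norm_le_seminorm ℂ (φ a) x
  have hsplit := hx.sum_add_tsum_subtype_compl s
  rw [sub_apply, hΦ, ← hsplit, sum_apply, add_sub_cancel_left]

/-- Uniform boundedness: a pointwise bounded family of continuous functionals on the Schwartz
space is uniformly bounded on every bounded family of Schwartz functions. -/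
theorem exists_uniform_bound {τ : Type*} (V : τ → 𝓢(Plane, ℂ) →L[ℂ] ℂ)
    (hV : ∀ φ, ∃ C, ∀ t, ‖V t φ‖ ≤ C) (φ : α → 𝓢(Plane, ℂ))
    (hφ : ∀ k n, ∃ C, ∀ a, SchwartzMap.seminorm ℂ k n (φ a) ≤ C) :
    ∃ C, ∀ t a, ‖V t (φ a)‖ ≤ C := by
  classical
  choose B hB using hφ
  have hc : ∀ c : lp (fun _ : α => ℂ) 1, HasSum (fun a => ‖c a‖) ‖c‖ := fun c => by
    simpa using lp.hasSum_norm (p := 1) (by simp) c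
  have hle : ∀ (c : lp (fun _ : α => ℂ) 1) k n a,
      SchwartzMap.seminorm ℂ k n (c a • φ a) ≤ B k n * ‖c a‖ := fun c k n a => by
    rw [map_smul_eq_mul, mul_comm]
    gcongr
    exact hB k n a
  have hsum : ∀ (c : lp (fun _ : α => ℂ) 1) k n,
      Summable fun a => SchwartzMap.seminorm ℂ k n (c a • φ a) := fun c k n =>
    Summable.of_nonneg_of_le (fun a => apply_nonneg _ _) (hle c k n)
      ((hc c).summable.mul_left (B k n))
  choose S hS hSle using fun c : lp (fun _ : α => ℂ) 1 => exists_hasSum_schwartzMap (hsum c)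
  -- The map c ↦ ∑ c_a φ_a carries the Banach space ℓ¹(α) into the Schwartz space. Banach–Steinhaus
  -- applies to the functionals pulled back along it, and the unit vectors recover the φ_a.
  let L : lp (fun _ : α => ℂ) 1 →ₗ[ℂ] 𝓢(Plane, ℂ) :=
    { toFun := S
      map_add' := fun c d => (hS (c + d)).unique (by
        convert (hS c).add (hS d) using 2 with a
        rw [lp.coeFn_add, Pi.add_apply, add_smul])
      map_smul' := fun r c => (hS (r • c)).unique (by
        change HasSum _ (r • S c)
        convert (hS c).const_smul r using 2 with a
        rw [lp.coeFn_smul, Pi.smul_apply, smul_assoc]) }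
  have hL : Continuous L := by
    refine (schwartz_withSeminorms ℂ Plane ℂ).continuous_normedSpace_dom _ L ?_
    rintro ⟨k, n⟩
    -- A negative bound `B k n` can occur only for empty α; the maximum with 0 covers it.
    have hle' : ∀ c, SchwartzMap.seminorm ℂ k n (S c) ≤ max (B k n) 0 * ‖c‖ := fun c =>
      calc _ ≤ ∑' a, B k n * ‖c a‖ := (hSle c k n).trans
            ((hsum c k n).tsum_le_tsum (hle c k n) ((hc c).summable.mul_left (B k n)))
        _ = B k n * ‖c‖ := by rw [tsum_mul_left, (hc c).tsum_eq]
        _ ≤ _ := mul_le_mul_of_nonneg_right (le_max_left _ _) (norm_nonneg _)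
    exact ⟨⟨max (B k n) 0, le_max_right _ _⟩, hle'⟩
  have hsingle : ∀ a, S (lp.single 1 a 1) = φ a := fun a =>
    (hS _).unique (by
      convert hasSum_single a ?_ using 1
      · simp
      · intro b hb
        simp [Pi.single_eq_of_ne hb])
  obtain ⟨C, hC⟩ := banach_steinhaus (g := fun t => (V t).comp (⟨L, hL⟩ :
    lp (fun _ : α => ℂ) 1 →L[ℂ] 𝓢(Plane, ℂ))) fun c => hV (S c)
  refine ⟨C, fun t a => ?_⟩
  have h1 := ((V t).comp (⟨L, hL⟩ : lp (fun _ : α => ℂ) 1 →L[ℂ] 𝓢(Plane, ℂ))).le_opNorm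
    (lp.single 1 a 1)
  rw [lp.norm_single (by simp), norm_one, mul_one] at h1
  rw [← hsingle a]
  exact h1.trans (hC t)

end UniformBoundedness

/-! ### Repeated multiplication by symbols on compactly supported functions. -/

section Words

variable {ι : Type} {m : ι → Plane → ℝ}

theorem norm_iteratedFDeriv_mulSymbol_le {g : Plane → ℝ} (hg : g.HasTemperateGrowth)
    (ρ : 𝓢(Plane, ℂ)) {n : ℕ} {K B : ℝ} {x : Plane} (hK : 0 ≤ K)
    (hgx : ∀ j ≤ n, ‖iteratedFDeriv ℝ j g x‖ ≤ K)
    (hρ : ∀ j ≤ n, ‖iteratedFDeriv ℝ j ρ x‖ ≤ B) :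
    ∀ j ≤ n, ‖iteratedFDeriv ℝ j (mulSymbol g ρ) x‖ ≤ 2 ^ n * K * B := by
  intro j hj
  have hB : 0 ≤ B := (norm_nonneg _).trans (hρ 0 (Nat.zero_le _))
  have hcoe : (mulSymbol g ρ : Plane → ℂ) = fun y => g y • ρ y :=
    funext fun y => SchwartzMap.smulLeftCLM_apply_apply hg ρ y
  rw [hcoe]
  calc _ ≤ ∑ i ∈ Finset.range (j + 1), (j.choose i : ℝ) * ‖iteratedFDeriv ℝ i g x‖ *
        ‖iteratedFDeriv ℝ (j - i) ρ x‖ :=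
        norm_iteratedFDeriv_smul_le hg.1 (ρ.smooth ⊤) x (by exact_mod_cast le_top)
    _ ≤ ∑ i ∈ Finset.range (j + 1), (j.choose i : ℝ) * K * B := by
        refine Finset.sum_le_sum fun i hi => ?_
        have hi' : i ≤ j := Nat.lt_succ_iff.1 (Finset.mem_range.1 hi)
        gcongr
        · exact hgx i (hi'.trans hj)
        · exact hρ (j - i) ((Nat.sub_le _ _).trans hj)
    _ = 2 ^ j * K * B := by
        rw [← Finset.sum_mul, ← Finset.sum_mul]
        congr 2
        exact_mod_cast Nat.sum_range_choose j
    _ ≤ 2 ^ n * K * B := by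
        gcongr
        norm_num

/-- Successive multiplication by the symbols named by the letters of a word. -/
def mulWord (m : ι → Plane → ℝ) (l : List ι) (ρ : 𝓢(Plane, ℂ)) : 𝓢(Plane, ℂ) :=
  l.foldr (fun i σ => mulSymbol (m i) σ) ρ

theorem tsupport_mulWord_subset (l : List ι) (ρ : 𝓢(Plane, ℂ)) :
    tsupport (mulWord m l ρ) ⊆ tsupport ρ := by
  induction l with
  | nil => exact subset_rfl
  | cons i l ih =>
    exact ((SchwartzMap.tsupport_smulLeftCLM_subset _ _).trans inter_subset_left).trans ih

/-- On a fixed ball the symbols have bounded derivatives, and multiplication does not enlarge the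
support, so by the Leibniz rule each letter costs one constant factor. -/
theorem exists_bound_mulWord [Finite ι] (hm : ∀ i, (m i).HasTemperateGrowth) {R : ℝ}
    {ρ : 𝓢(Plane, ℂ)} (hρ : tsupport ρ ⊆ Metric.closedBall 0 R) (n : ℕ) :
    ∃ B M : ℝ, 0 ≤ B ∧ 0 ≤ M ∧ ∀ l x, ‖iteratedFDeriv ℝ n (mulWord m l ρ) x‖ ≤
      M ^ l.length * B := by
  have := Fintype.ofFinite ι
  choose k C hC hbound using fun i => (hm i).norm_iteratedFDeriv_le_uniform n
  let K : ℝ := ∑ i, C i * (1 + |R|) ^ k i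
  have hK : 0 ≤ K := Finset.sum_nonneg fun i _ => mul_nonneg (hC i) (by positivity)
  let B : ℝ := ∑ j ∈ Finset.range (n + 1), SchwartzMap.seminorm ℂ 0 j ρ
  have hB : 0 ≤ B := Finset.sum_nonneg fun j _ => apply_nonneg _ _
  have hsymbol : ∀ i, ∀ x ∈ Metric.closedBall (0 : Plane) R, ∀ j ≤ n,
      ‖iteratedFDeriv ℝ j (m i) x‖ ≤ K := fun i x hx j hj => by
    rw [mem_closedBall_zero_iff] at hx
    calc _ ≤ C i * (1 + ‖x‖) ^ k i := hbound i j hj x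
      _ ≤ C i * (1 + |R|) ^ k i := by
        have := hC i
        have := hx.trans (le_abs_self R)
        gcongr
      _ ≤ K := Finset.single_le_sum (f := fun i => C i * (1 + |R|) ^ k i)
        (fun i _ => mul_nonneg (hC i) (by positivity)) (Finset.mem_univ i)
  have hword : ∀ x ∈ Metric.closedBall (0 : Plane) R, ∀ l, ∀ j ≤ n,
      ‖iteratedFDeriv ℝ j (mulWord m l ρ) x‖ ≤ (2 ^ n * K) ^ l.length * B := by
    intro x hx l
    induction l with
    | nil =>
      intro j hj
      rw [List.length_nil, pow_zero, one_mul]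
      exact (SchwartzMap.norm_iteratedFDeriv_le_seminorm ℂ ρ j x).trans
        (Finset.single_le_sum (f := fun j => SchwartzMap.seminorm ℂ 0 j ρ)
          (fun j _ => apply_nonneg _ _) (Finset.mem_range.2 (Nat.lt_succ_of_le hj)))
    | cons i l ih =>
      rw [List.length_cons, pow_succ', mul_assoc]
      exact norm_iteratedFDeriv_mulSymbol_le (hm i) _ hK (hsymbol i x hx) ih
  refine ⟨B, 2 ^ n * K, hB, by positivity, fun l x => ?_⟩
  by_cases hx : x ∈ Metric.closedBall (0 : Plane) R
  · exact hword x hx l n le_rfl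
  · have h0 : iteratedFDeriv ℝ n (mulWord m l ρ) x = 0 := by
      by_contra h
      exact hx (hρ (tsupport_mulWord_subset l ρ (support_iteratedFDeriv_subset n h)))
    rw [h0, norm_zero]
    positivity

/-- The words of symbols, divided by the factorial of their length, act boundedly on a Schwartz
function of compact support. -/
theorem exists_seminorm_mulWord_le [Finite ι] (hm : ∀ i, (m i).HasTemperateGrowth) {R : ℝ}
    {ρ : 𝓢(Plane, ℂ)} (hρ : tsupport ρ ⊆ Metric.closedBall 0 R) (k n : ℕ) :
    ∃ C, ∀ l : List ι, SchwartzMap.seminorm ℂ k n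
      (((l.length.factorial : ℂ)⁻¹) • mulWord m l ρ) ≤ C := by
  obtain ⟨B, M, hB, hM, h⟩ := exists_bound_mulWord hm hρ n
  -- The rate M depends on the order n of the seminorm. Dividing by the factorial absorbs every such
  -- rate through M^N/N! ≤ exp M, so one normalization serves for all seminorms.
  refine ⟨|R| ^ k * (Real.exp M * B), fun l => ?_⟩
  have hword : SchwartzMap.seminorm ℂ k n (mulWord m l ρ) ≤ |R| ^ k * (M ^ l.length * B) := by
    refine SchwartzMap.seminorm_le_bound ℂ k n _ (by positivity) fun x => ?_
    by_cases hx : x ∈ Metric.closedBall (0 : Plane) R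
    · rw [mem_closedBall_zero_iff] at hx
      have := hx.trans (le_abs_self R)
      gcongr
      exact h l x
    · have h0 : iteratedFDeriv ℝ n (mulWord m l ρ) x = 0 := by
        by_contra h
        exact hx (hρ (tsupport_mulWord_subset l ρ (support_iteratedFDeriv_subset n h)))
      rw [h0, norm_zero, mul_zero]
      positivity
  rw [map_smul_eq_mul, norm_inv, Complex.norm_natCast]
  calc _ ≤ (l.length.factorial : ℝ)⁻¹ * (|R| ^ k * (M ^ l.length * B)) := by gcongr
    _ = |R| ^ k * (M ^ l.length / l.length.factorial * B) := by ring
    _ ≤ _ := by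
      gcongr
      exact Real.pow_div_factorial_le_exp M hM _

end Words

/-! ### Density of the compactly supported Schwartz functions. -/

section Density

/-- The dilation `x ↦ χ(x/r)` of a cutoff function. -/
def dilate (χ : Plane → ℝ) (r : ℝ) (x : Plane) : ℝ := χ (r⁻¹ • x)

theorem norm_iteratedFDeriv_dilate_le {χ : Plane → ℝ} (hχ : ContDiff ℝ (⊤ : ℕ∞) χ) {r : ℝ} (hr : 1 ≤ r)
    (n : ℕ) (x : Plane) :
    ‖iteratedFDeriv ℝ n (dilate χ r) x‖ ≤ ‖iteratedFDeriv ℝ n χ (r⁻¹ • x)‖ := by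
  let g : Plane →L[ℝ] Plane := r⁻¹ • ContinuousLinearMap.id ℝ Plane
  have hg : ‖g‖ ≤ 1 := ContinuousLinearMap.opNorm_le_bound _ zero_le_one fun x => by
    change ‖r⁻¹ • x‖ ≤ 1 * ‖x‖
    rw [norm_smul, norm_inv, Real.norm_of_nonneg (by linarith)]
    gcongr
    exact inv_le_one_of_one_le₀ hr
  have hcomp : dilate χ r = χ ∘ g := rfl
  rw [hcomp, g.iteratedFDeriv_comp_right hχ x (by exact_mod_cast le_top)]
  refine (ContinuousMultilinearMap.norm_compContinuousLinearMap_le _ _).trans ?_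
  rw [Finset.prod_const]
  exact mul_le_of_le_one_right (norm_nonneg _) (pow_le_one₀ (norm_nonneg _) hg)

/-- The difference vanishes where |x| < r. Elsewhere one extra power of |x|, paid for by the
seminorm of index k + 1, yields the factor 1/r. -/
theorem seminorm_sub_cutoff_le {g : Plane → ℝ} (hg : g.HasTemperateGrowth) (ρ : 𝓢(Plane, ℂ))
    {r K : ℝ} (hr : 0 < r) (hone : ∀ x, ‖x‖ < r → g x = 1) (k n : ℕ) (hK : 0 ≤ K)
    (hgx : ∀ x, ∀ j ≤ n, ‖iteratedFDeriv ℝ j g x‖ ≤ K) :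
    SchwartzMap.seminorm ℂ k n (mulSymbol g ρ - ρ) ≤ r⁻¹ *
      ((2 ^ n * K + 1) * ∑ j ∈ Finset.range (n + 1), SchwartzMap.seminorm ℂ (k + 1) j ρ) := by
  have hS : 0 ≤ ∑ j ∈ Finset.range (n + 1), SchwartzMap.seminorm ℂ (k + 1) j ρ :=
    Finset.sum_nonneg fun j _ => apply_nonneg _ _
  refine SchwartzMap.seminorm_le_bound ℂ k n _ (by positivity) fun x => ?_
  rcases lt_or_ge ‖x‖ r with hx | hx
  · have h0 : (mulSymbol g ρ - ρ : 𝓢(Plane, ℂ)) =ᶠ[𝓝 x] fun _ => 0 := by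
      filter_upwards [(isOpen_lt continuous_norm continuous_const).mem_nhds hx] with y hy
      rw [sub_apply, mulSymbol_apply hg, hone y hy]
      simp
    rw [h0.iteratedFDeriv ℝ n |>.eq_of_nhds]
    rw [iteratedFDeriv_fun_zero]
    simp only [Pi.zero_apply, norm_zero, mul_zero]
    positivity
  · have hx0 : 0 < ‖x‖ := hr.trans_le hx
    let S : ℝ := ∑ j ∈ Finset.range (n + 1), SchwartzMap.seminorm ℂ (k + 1) j ρ
    have hρ : ∀ j ≤ n, ‖iteratedFDeriv ℝ j ρ x‖ ≤ S / ‖x‖ ^ (k + 1) := fun j hj => by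
      rw [le_div_iff₀ (by positivity), mul_comm]
      exact (SchwartzMap.le_seminorm ℂ (k + 1) j ρ x).trans
        (Finset.single_le_sum (f := fun j => SchwartzMap.seminorm ℂ (k + 1) j ρ)
          (fun j _ => apply_nonneg _ _) (Finset.mem_range.2 (Nat.lt_succ_of_le hj)))
    have hsub : iteratedFDeriv ℝ n (mulSymbol g ρ - ρ : 𝓢(Plane, ℂ)) x =
        iteratedFDeriv ℝ n (mulSymbol g ρ) x - iteratedFDeriv ℝ n ρ x :=
      iteratedFDeriv_sub_apply ((mulSymbol g ρ).smooth n).contDiffAt (ρ.smooth n).contDiffAt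
    rw [hsub]
    calc _ ≤ ‖x‖ ^ k * (2 ^ n * K * (S / ‖x‖ ^ (k + 1)) + S / ‖x‖ ^ (k + 1)) := by
          gcongr
          exact (norm_sub_le _ _).trans (add_le_add
            (norm_iteratedFDeriv_mulSymbol_le hg ρ hK (hgx x) hρ n le_rfl) (hρ n le_rfl))
      _ = ‖x‖⁻¹ * ((2 ^ n * K + 1) * S) := by
          rw [pow_succ]
          field_simp
      _ ≤ _ := by
          gcongr

/-- The Schwartz functions of compact support are dense. -/
theorem eq_zero_of_compactSupport {T : 𝓢(Plane, ℂ) →L[ℂ] ℂ}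
    (hT : ∀ (R : ℝ) (ρ : 𝓢(Plane, ℂ)), tsupport ρ ⊆ Metric.closedBall 0 R → T ρ = 0) : T = 0 := by
  ext ρ
  let χ : ContDiffBump (0 : Plane) := ⟨1, 2, one_pos, one_lt_two⟩
  have hχ : ContDiff ℝ (⊤ : ℕ∞) χ := χ.contDiff
  have hχbound : ∀ j, ∃ K, ∀ x, ‖iteratedFDeriv ℝ j χ x‖ ≤ K := fun j =>
    (χ.hasCompactSupport.iteratedFDeriv j).exists_bound_of_continuous
      (hχ.continuous_iteratedFDeriv (by exact_mod_cast le_top))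
  choose K hK using hχbound
  have hsupp : ∀ r : ℝ, 1 ≤ r → tsupport (dilate χ r) ⊆ Metric.closedBall 0 (2 * r) := by
    intro r hr
    refine closure_minimal (fun x hx => ?_) Metric.isClosed_closedBall
    have h2 : r⁻¹ • x ∈ Function.support χ := hx
    rw [χ.support_eq, mem_ball_zero_iff, norm_smul, norm_inv, Real.norm_of_nonneg (by linarith),
      inv_mul_lt_iff₀ (by linarith)] at h2
    rw [mem_closedBall_zero_iff, mul_comm]
    exact h2.le
  have hgrowth : ∀ r : ℝ, 1 ≤ r → (dilate χ r).HasTemperateGrowth := fun r hr =>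
    HasCompactSupport.hasTemperateGrowth
      ((isCompact_closedBall (0 : Plane) (2 * r)).of_isClosed_subset isClosed_closure (hsupp r hr))
      (hχ.comp (contDiff_const_smul _))
  have hlim : Tendsto (fun r : ℝ => mulSymbol (dilate χ r) ρ) atTop (𝓝 ρ) := by
    rw [(schwartz_withSeminorms ℂ Plane ℂ).tendsto_nhds]
    rintro ⟨k, n⟩ ε hε
    let M : ℝ := ∑ j ∈ Finset.range (n + 1), |K j|
    have hM : ∀ j ≤ n, |K j| ≤ M := fun j hj =>
      Finset.single_le_sum (f := fun j => |K j|) (fun j _ => abs_nonneg _)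
        (Finset.mem_range.2 (Nat.lt_succ_of_le hj))
    have h0 : Tendsto (fun r : ℝ => r⁻¹ * ((2 ^ n * M + 1) *
        ∑ j ∈ Finset.range (n + 1), SchwartzMap.seminorm ℂ (k + 1) j ρ)) atTop (𝓝 0) := by
      simpa using tendsto_inv_atTop_zero.mul_const ((2 ^ n * M + 1) *
        ∑ j ∈ Finset.range (n + 1), SchwartzMap.seminorm ℂ (k + 1) j ρ)
    filter_upwards [h0.eventually (gt_mem_nhds hε), eventually_ge_atTop 1] with r hr hr1
    refine lt_of_le_of_lt ?_ hr
    refine seminorm_sub_cutoff_le (hgrowth r hr1) ρ (by linarith) (fun x hx => ?_) k n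
      (Finset.sum_nonneg fun j _ => abs_nonneg _) fun x j hj =>
        (norm_iteratedFDeriv_dilate_le hχ hr1 j x).trans
          ((hK j _).trans ((le_abs_self _).trans (hM j hj)))
    refine χ.one_of_mem_closedBall ?_
    rw [mem_closedBall_zero_iff, norm_smul, norm_inv, Real.norm_of_nonneg (by linarith),
      inv_mul_le_iff₀ (by linarith), mul_one]
    exact hx.le
  have hzero : Tendsto (fun r : ℝ => T (mulSymbol (dilate χ r) ρ)) atTop (𝓝 0) := by
    refine tendsto_const_nhds.congr' ?_
    filter_upwards [eventually_ge_atTop 1] with r hr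
    exact (hT (2 * r) _ (((SchwartzMap.tsupport_smulLeftCLM_subset _ _).trans inter_subset_right).trans
      (hsupp r hr))).symm
  exact tendsto_nhds_unique ((T.continuous.tendsto ρ).comp hlim) hzero

end Density

/-! ### Estimates from the mixed derivative. -/

section MixedDerivative

theorem norm_sub_le_of_norm_deriv_le_pow {f f' : ℝ → ℂ} {a b C : ℝ} {n : ℕ} (ha : 0 ≤ a)
    (hab : a ≤ b) (hC : 0 ≤ C) (hf : ∀ x ∈ Icc a b, HasDerivAt f (f' x) x)
    (hbound : ∀ x ∈ Icc a b, ‖f' x‖ ≤ C * x ^ n) :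
    ‖f b - f a‖ ≤ C / (n + 1) * b ^ (n + 1) := by
  have hB : ∀ x : ℝ, HasDerivAt (fun x : ℝ => C / (n + 1) * x ^ (n + 1)) (C * x ^ n) x := fun x => by
    refine ((hasDerivAt_pow (n + 1) x).const_mul (C / (n + 1))).congr_deriv ?_
    have : (n + 1 : ℝ) ≠ 0 := by positivity
    push_cast
    field_simp
  refine image_norm_le_of_norm_deriv_right_le_deriv_boundary' (f := fun x => f x - f a)
    (f' := f') (B := fun x => C / (n + 1) * x ^ (n + 1)) (B' := fun x => C * x ^ n) (a := a)
    (b := b) (fun x hx => ((hf x hx).sub_const _).continuousAt.continuousWithinAt)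
    (fun x hx => ((hf x (Ico_subset_Icc_self hx)).sub_const _).hasDerivWithinAt) ?_
    (fun x _ => (hB x).continuousAt.continuousWithinAt) (fun x _ => (hB x).hasDerivWithinAt)
    (fun x hx => hbound x (Ico_subset_Icc_self hx)) (right_mem_Icc.2 hab)
  simp only [sub_self, norm_zero]
  positivity

/-- A function on the closed quadrant that vanishes on the axes is controlled by its mixed
derivative. -/
theorem norm_le_of_norm_mixed_derivative_le {f w : ℝ → ℝ → ℂ} {X Y C : ℝ} {n : ℕ} (hC : 0 ≤ C)
    (hcont : ContinuousOn (fun p : ℝ × ℝ => f p.1 p.2) {p | 0 ≤ p.1 ∧ 0 ≤ p.2})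
    (haxis : ∀ x y, 0 ≤ x → 0 ≤ y → x * y = 0 → f x y = 0)
    (hdiff : ∀ x y, 0 < x → 0 < y → DifferentiableAt ℝ (f x) y)
    (hmixed : ∀ x y, 0 < x → 0 < y → HasDerivAt (fun x => deriv (f x) y) (w x y) x)
    (hw : ∀ x y, 0 < x → x ≤ X → 0 < y → y ≤ Y → ‖w x y‖ ≤ C * (x * y) ^ n)
    {x y : ℝ} (hx : 0 ≤ x) (hxX : x ≤ X) (hy : 0 ≤ y) (hyY : y ≤ Y) :
    ‖f x y‖ ≤ C / (n + 1) ^ 2 * (x * y) ^ (n + 1) := by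
  rcases hx.eq_or_lt with rfl | hx
  · rw [haxis 0 y le_rfl hy (zero_mul y)]
    simp
  rcases hy.eq_or_lt with rfl | hy
  · rw [haxis x 0 hx.le le_rfl (mul_zero x)]
    simp
  -- The derivatives exist only off the axes, so the mixed derivative is integrated over [ε, x] ×
  -- [ε, y]; the three other corner values tend to 0 with ε by continuity.
  have hrect : ∀ ε, 0 < ε → ε ≤ x → ε ≤ y →
      ‖(f x y - f ε y) - (f x ε - f ε ε)‖ ≤ C / (n + 1) ^ 2 * (x * y) ^ (n + 1) := by
    intro ε hε hεx hεy
    have hpartial : ∀ t ∈ Icc ε y, ‖deriv (f x) t - deriv (f ε) t‖ ≤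
        C / (n + 1) * x ^ (n + 1) * t ^ n := fun t ht => by
      have ht0 : 0 < t := hε.trans_le ht.1
      refine (norm_sub_le_of_norm_deriv_le_pow (f := fun s => deriv (f s) t)
        (C := C * t ^ n) (n := n) hε.le hεx (by positivity)
        (fun s hs => hmixed s t (hε.trans_le hs.1) ht0) fun s hs => ?_).trans_eq (by ring)
      refine (hw s t (hε.trans_le hs.1) (hs.2.trans hxX) ht0 (ht.2.trans hyY)).trans_eq ?_
      rw [mul_pow]
      ring
    refine (norm_sub_le_of_norm_deriv_le_pow (f := fun t => f x t - f ε t)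
      (C := C / (n + 1) * x ^ (n + 1)) (n := n) hε.le hεy (by positivity)
      (fun t ht => (hdiff x t hx (hε.trans_le ht.1)).hasDerivAt.sub
        (hdiff ε t hε (hε.trans_le ht.1)).hasDerivAt) hpartial).trans_eq ?_
    rw [mul_pow]
    field_simp
  have hlim : ∀ u v : ℝ → ℝ, Continuous u → Continuous v → (∀ ε, 0 < ε → 0 ≤ u ε) →
      (∀ ε, 0 < ε → 0 ≤ v ε) → 0 ≤ u 0 → 0 ≤ v 0 →
      Tendsto (fun ε => f (u ε) (v ε)) (𝓝[>] 0) (𝓝 (f (u 0) (v 0))) := by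
    intro u v hu hv hu0 hv0 hu1 hv1
    refine Tendsto.comp (f := fun ε => (u ε, v ε)) (hcont (u 0, v 0) ⟨hu1, hv1⟩).tendsto
      (tendsto_nhdsWithin_iff.2 ⟨?_, ?_⟩)
    · exact ((hu.prodMk hv).tendsto 0).mono_left nhdsWithin_le_nhds
    · filter_upwards [self_mem_nhdsWithin] with ε hε
      exact ⟨hu0 ε hε, hv0 ε hε⟩
  have hid : ∀ ε : ℝ, 0 < ε → 0 ≤ ε := fun ε => le_of_lt
  have h1 := hlim (fun ε => ε) (fun _ => y) continuous_id continuous_const hid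
    (fun _ _ => hy.le) le_rfl hy.le
  have h2 := hlim (fun _ => x) (fun ε => ε) continuous_const continuous_id
    (fun _ _ => hx.le) hid hx.le le_rfl
  have h3 := hlim (fun ε => ε) (fun ε => ε) continuous_id continuous_id hid hid le_rfl le_rfl
  simp only [haxis 0 y le_rfl hy.le (zero_mul y), haxis x 0 hx.le le_rfl (mul_zero x),
    haxis 0 0 le_rfl le_rfl (mul_zero 0)] at h1 h2 h3
  have hlimit := (((tendsto_const_nhds (x := f x y)).sub h1).sub (h2.sub h3)).norm
  rw [sub_zero, sub_zero, sub_zero] at hlimit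
  refine le_of_tendsto hlimit ?_
  filter_upwards [Ioc_mem_nhdsGT (lt_min hx hy)] with ε hε
  exact hrect ε hε.1 (hε.2.trans (min_le_left _ _)) (hε.2.trans (min_le_right _ _))

end MixedDerivative

/-! ### Uniqueness for the characteristic problem. -/

section Uniqueness

variable {ι : Type} [Fintype ι] {m : ι → Plane → ℝ} {a : ℝ → ι → ℝ}
  {F : ℝ → ℝ → 𝓢(Plane, ℂ) →L[ℂ] ℂ}

/-- A family of functionals with zero characteristic data whose mixed derivative is given by
multiplication of the test function by symbols. -/
structure IsNullGoursatFamily (m : ι → Plane → ℝ) (a : ℝ → ι → ℝ)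
    (F : ℝ → ℝ → 𝓢(Plane, ℂ) →L[ℂ] ℂ) : Prop where
  continuousOn : ∀ ρ, ContinuousOn (fun p : ℝ × ℝ => F p.1 p.2 ρ) {p | 0 ≤ p.1 * p.2}
  boundary : ∀ x y, x * y = 0 → F x y = 0
  differentiable : ∀ ρ x y, 0 < x * y → DifferentiableAt ℝ (fun y => F x y ρ) y
  equation : ∀ ρ x y, 0 < x * y →
    ∃ w : ℂ, HasDerivAt (fun x => deriv (fun y => F x y ρ) y) w x ∧
      4 * w = -∑ i, (a x i : ℂ) * F x y (mulSymbol (m i) ρ)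

/-- Carries the quadrant x, y ≤ 0 to the positive one; the two sign changes cancel in the mixed
derivative. -/
theorem IsNullGoursatFamily.reflect (hF : IsNullGoursatFamily m a F) :
    IsNullGoursatFamily m (fun x => a (-x)) (fun x y => F (-x) (-y)) where
  continuousOn ρ := by
    refine (hF.continuousOn ρ).comp (f := fun p : ℝ × ℝ => (-p.1, -p.2)) (by fun_prop)
      fun p hp => ?_
    simpa using hp
  boundary x y h := hF.boundary _ _ (by rwa [neg_mul_neg])
  differentiable ρ x y h :=
    (hF.differentiable ρ (-x) (-y) (by rwa [neg_mul_neg])).comp y differentiableAt_id.neg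
  equation ρ x y h := by
    obtain ⟨w, hw, heq⟩ := hF.equation ρ (-x) (-y) (by rwa [neg_mul_neg])
    refine ⟨w, ?_, heq⟩
    have hd : (fun x => deriv (fun y => F (-x) (-y) ρ) y) =
        fun x => -deriv (fun y => F (-x) y ρ) (-y) :=
      funext fun x => deriv_comp_neg (fun y => F (-x) y ρ) y
    rw [hd]
    exact (hw.scomp x (hasDerivAt_neg x)).neg.congr_deriv (by simp)

/-- Picard iteration in n. The equation lengthens the word by one letter, turning (|l|+n)! into
(|l|+n+1)!, and the double integration contributes xy/(n+1)². The claim must therefore cover all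
words at once. -/
theorem norm_mulWord_le (hm : ∀ i, (m i).HasTemperateGrowth) (ha : Continuous a)
    (hF : IsNullGoursatFamily m a F) {ρ : 𝓢(Plane, ℂ)} {R : ℝ}
    (hρ : tsupport ρ ⊆ Metric.closedBall 0 R) (X Y : ℝ) :
    ∃ C α : ℝ, 0 ≤ C ∧ 0 ≤ α ∧ ∀ n l x y, 0 ≤ x → x ≤ X → 0 ≤ y → y ≤ Y →
      ‖F x y (mulWord m l ρ)‖ ≤
        C * α ^ n * (l.length + n).factorial / (n.factorial : ℝ) ^ 2 * (x * y) ^ n := by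
  let K : Set (ℝ × ℝ) := Icc 0 X ×ˢ Icc 0 Y
  have hK : IsCompact K := isCompact_Icc.prod isCompact_Icc
  have hKpos : ∀ p ∈ K, 0 ≤ p.1 * p.2 := fun p hp => mul_nonneg hp.1.1 hp.2.1
  -- Start of the iteration: weak continuity bounds F pointwise on the compact rectangle, and
  -- uniform boundedness over the normalized words gives C |l|!.
  obtain ⟨C, hC⟩ := exists_uniform_bound (fun p : K => F p.1.1 p.1.2)
    (fun φ => by
      obtain ⟨C, hC⟩ := hK.exists_bound_of_continuousOn ((hF.continuousOn φ).mono hKpos)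
      exact ⟨C, fun p => hC p.1 p.2⟩)
    (fun l : List ι => ((l.length.factorial : ℂ)⁻¹) • mulWord m l ρ)
    (exists_seminorm_mulWord_le hm hρ)
  obtain ⟨α, hα⟩ := (isCompact_Icc (a := (0 : ℝ)) (b := X)).exists_bound_of_continuousOn
    (f := fun x => ∑ i, |a x i|) (Continuous.continuousOn (by fun_prop))
  refine ⟨|C|, |α|, abs_nonneg _, abs_nonneg _, fun n => ?_⟩
  induction n with
  | zero =>
    intro l x y hx hxX hy hyY
    have h := hC ⟨(x, y), ⟨hx, hxX⟩, ⟨hy, hyY⟩⟩ l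
    have hpos : (0 : ℝ) < l.length.factorial := by exact_mod_cast Nat.factorial_pos _
    rw [map_smul, norm_smul, norm_inv, Complex.norm_natCast, inv_mul_le_iff₀ hpos] at h
    calc _ ≤ _ := h
      _ ≤ l.length.factorial * |C| := by
        gcongr
        exact le_abs_self C
      _ = _ := by
        simp
        ring
  | succ n ih =>
    intro l x y hx hxX hy hyY
    choose! w hw heq using fun x y => hF.equation (mulWord m l ρ) x y
    have key := norm_le_of_norm_mixed_derivative_le
      (f := fun x y => F x y (mulWord m l ρ)) (w := w) (X := X) (Y := Y)
      (C := |C| * |α| ^ (n + 1) * (l.length + (n + 1)).factorial / (n.factorial : ℝ) ^ 2)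
      (n := n) (by positivity)
      ((hF.continuousOn _).mono fun p hp => mul_nonneg hp.1 hp.2)
      (fun x y _ _ h => by
        rw [hF.boundary x y h]
        rfl)
      (fun x y hx hy => hF.differentiable _ x y (mul_pos hx hy))
      (fun x y hx hy => hw x y (mul_pos hx hy)) ?_ hx hxX hy hyY
    · refine key.trans_eq ?_
      rw [Nat.factorial_succ n]
      push_cast
      field_simp
    · intro x y hx hxX hy hyY
      let D : ℝ := |C| * |α| ^ n * (l.length + (n + 1)).factorial / (n.factorial : ℝ) ^ 2 *
        (x * y) ^ n
      have hD : 0 ≤ D := by positivity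
      have hsum : ‖∑ i, (a x i : ℂ) * F x y (mulSymbol (m i) (mulWord m l ρ))‖ ≤ |α| * D :=
        calc _ ≤ ∑ i, |a x i| * D := by
              refine norm_sum_le_of_le _ fun i _ => ?_
              rw [norm_mul, Complex.norm_real, Real.norm_eq_abs]
              gcongr
              refine (ih (i :: l) x y hx.le hxX hy.le hyY).trans_eq ?_
              rw [List.length_cons, show l.length + 1 + n = l.length + (n + 1) by ring]
          _ = (∑ i, |a x i|) * D := by rw [Finset.sum_mul]
          _ ≤ |α| * D := by
              gcongr
              exact ((le_abs_self _).trans (hα x ⟨hx.le, hxX⟩)).trans (le_abs_self α)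
      have hnorm := congrArg norm (heq x y (mul_pos hx hy))
      rw [norm_mul, norm_neg, Complex.norm_ofNat] at hnorm
      -- The factor 4 in front of w is simply discarded.
      calc ‖w x y‖ ≤ |α| * D := by linarith [norm_nonneg (w x y)]
        _ = _ := by
          simp only [D]
          ring

/-- For the empty word the estimate is C (α xy)ⁿ/n!, which tends to 0; density handles the remaining
test functions. -/
theorem IsNullGoursatFamily.eq_zero_of_nonneg (hm : ∀ i, (m i).HasTemperateGrowth)
    (ha : Continuous a) (hF : IsNullGoursatFamily m a F) {x y : ℝ} (hx : 0 ≤ x) (hy : 0 ≤ y) :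
    F x y = 0 := by
  refine eq_zero_of_compactSupport fun R ρ hρ => ?_
  obtain ⟨C, α, hC, hα, h⟩ := norm_mulWord_le hm ha hF hρ x y
  have hlim : Tendsto (fun n : ℕ => C * ((α * (x * y)) ^ n / n.factorial)) atTop (𝓝 0) := by
    simpa using (FloorSemiring.tendsto_pow_div_factorial_atTop (α * (x * y))).const_mul C
  refine norm_le_zero_iff.1 (ge_of_tendsto' hlim fun n => ?_)
  refine (h n [] x y hx le_rfl hy le_rfl).trans_eq ?_
  have hpos : (n.factorial : ℝ) ≠ 0 := by exact_mod_cast n.factorial_ne_zero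
  rw [List.length_nil, zero_add, mul_pow α]
  field_simp

/-- Uniqueness for the characteristic problem. -/
theorem IsNullGoursatFamily.eq_zero (hm : ∀ i, (m i).HasTemperateGrowth) (ha : Continuous a)
    (hF : IsNullGoursatFamily m a F) {x y : ℝ} (hxy : 0 ≤ x * y) : F x y = 0 := by
  rcases mul_nonneg_iff.1 hxy with ⟨hx, hy⟩ | ⟨hx, hy⟩
  · exact hF.eq_zero_of_nonneg hm ha hx hy
  · simpa using hF.reflect.eq_zero_of_nonneg hm (ha.comp continuous_neg)
      (neg_nonneg.2 hx) (neg_nonneg.2 hy)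

/-- The functional `ρ ↦ T (𝓕 ρ)` on the Schwartz space. -/
def fourierPairing (T : 𝓢'(Plane, ℂ)) : 𝓢(Plane, ℂ) →L[ℂ] ℂ where
  toFun ρ := T (𝓕 ρ)
  map_add' ρ σ := by rw [FourierTransform.fourier_add, map_add]
  map_smul' r ρ := by rw [FourierTransform.fourier_smul, map_smul, RingHom.id_apply]
  cont := T.cont.comp (FourierTransform.fourierCLM ℂ 𝓢(Plane, ℂ)).continuous

theorem fourierPairing_apply (T : 𝓢'(Plane, ℂ)) (ρ : 𝓢(Plane, ℂ)) :
    fourierPairing T ρ = T (𝓕 ρ) := rfl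

/-- On the Fourier side the derivatives in x become multiplications by the four symbols, to which
the word estimates apply. -/
theorem isNullGoursatFamily_sub {e ħ c k₀ : ℝ} {A : ℝ → Plane} {U V : ℝ → ℝ → 𝓢'(Plane, ℂ)}
    (hU : IsFundamentalSolution e ħ c k₀ A U) (hV : IsFundamentalSolution e ħ c k₀ A V) :
    IsNullGoursatFamily symbol (fun x => symbolCoeff e ħ c k₀ (A x))
      (fun x y => fourierPairing (U x y) - fourierPairing (V x y)) where
  continuousOn ρ := (hU.continuousOn (𝓕 ρ)).sub (hV.continuousOn (𝓕 ρ))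
  boundary x y h := by rw [hU.boundary x y h, hV.boundary x y h, sub_self]
  differentiable ρ x y h := (hU.differentiable (𝓕 ρ) x y h).sub (hV.differentiable (𝓕 ρ) x y h)
  equation ρ x y h := by
    obtain ⟨u, hu, hueq⟩ := hU.equation (𝓕 ρ) x y h
    obtain ⟨v, hv, hveq⟩ := hV.equation (𝓕 ρ) x y h
    refine ⟨u - v, (hu.sub hv).congr_of_eventuallyEq ?_, ?_⟩
    · have hopen : IsOpen {s : ℝ | 0 < s * y} := isOpen_lt continuous_const (by fun_prop)
      filter_upwards [hopen.mem_nhds h] with s hs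
      exact deriv_sub (hU.differentiable (𝓕 ρ) s y hs) (hV.differentiable (𝓕 ρ) s y hs)
    · rw [transverseOperator_fourier] at hueq hveq
      simp only [sub_apply, fourierPairing_apply, mul_sub,
        Finset.sum_sub_distrib]
      linear_combination hveq - hueq

theorem IsFundamentalSolution.unique {e ħ c k₀ : ℝ} {A : ℝ → Plane} (hA : Continuous A)
    {U V : ℝ → ℝ → 𝓢'(Plane, ℂ)} (hU : IsFundamentalSolution e ħ c k₀ A U)
    (hV : IsFundamentalSolution e ħ c k₀ A V) {ξ η : ℝ} (h : 0 ≤ ξ * η) : U ξ η = V ξ η := by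
  have h0 := (isNullGoursatFamily_sub hU hV).eq_zero hasTemperateGrowth_symbol
    ((continuous_symbolCoeff e ħ c k₀).comp hA) h
  ext φ
  have := DFunLike.congr_fun h0 (𝓕⁻ φ)
  rw [sub_apply, fourierPairing_apply, fourierPairing_apply,
    FourierTransform.fourier_fourierInv_eq] at this
  exact sub_eq_zero.1 this

end Uniqueness

end Volkov

end

theorem mainTheorem1 (e ħ c k₀ : ℝ) (hħ : 0 < ħ) (hc : 0 < c) (hk₀ : 0 < k₀)
    (A : ℝ → Volkov.Plane) (hA : Continuous A) :
    Volkov.IsFundamentalSolution e ħ c k₀ A (Volkov.volkovSolution e ħ c k₀ A) ∧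
    (∀ U : ℝ → ℝ → 𝓢'(Volkov.Plane, ℂ), Volkov.IsFundamentalSolution e ħ c k₀ A U →
      ∀ ξ η : ℝ, 0 ≤ ξ * η → U ξ η = Volkov.volkovSolution e ħ c k₀ A ξ η) ∧
    (∀ ξ η : ℝ, 0 ≤ ξ * η → ∀ φ : 𝓢(Volkov.Plane, ℂ),
      Volkov.volkovSolution e ħ c k₀ A ξ η φ =
        1 / (4 * (Real.pi : ℂ) ^ 2) * ∫ k : Volkov.Plane,
          (Volkov.besselJ 0
            √(ξ * η * Volkov.average (Volkov.momentumParameter e ħ c k₀ A k) ξ) : ℂ) *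
          ∫ x : Volkov.Plane, Complex.exp (Complex.I * (inner ℝ k x : ℝ)) * φ x) ∧
    (ContDiff ℝ 1 A → ∀ φ : 𝓢(Volkov.Plane, ℂ),
      ContDiffOn ℝ 2
        (fun p : ℝ × ℝ =>
          Volkov.volkovSolution e ħ c k₀ A (c * p.2 - p.1) (c * p.2 + p.1) φ)
        {p | 0 < c ^ 2 * p.2 ^ 2 - p.1 ^ 2} ∧
      ∀ z t : ℝ, 0 < c ^ 2 * t ^ 2 - z ^ 2 →
        iteratedDeriv 2
          (fun z' => Volkov.volkovSolution e ħ c k₀ A (c * t - z') (c * t + z') φ) z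
        - 1 / (c : ℂ) ^ 2 * iteratedDeriv 2
          (fun t' => Volkov.volkovSolution e ħ c k₀ A (c * t' - z) (c * t' + z) φ) t
        + Volkov.transverseOperator e ħ c k₀ (A (c * t - z))
            (Volkov.volkovSolution e ħ c k₀ A (c * t - z) (c * t + z)) φ = 0) :=
  ⟨Volkov.isFundamentalSolution_volkovSolution hħ hc hk₀ hA,
    fun _ hU _ _ h => hU.unique hA (Volkov.isFundamentalSolution_volkovSolution hħ hc hk₀ hA) h,
    fun _ _ h φ => Volkov.volkovSolution_eq_integral hħ hc hk₀ hA h φ,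
    fun hA1 φ => Volkov.volkovSolution_wave_equation hħ hc hk₀ hA1 φ⟩
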